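/- **Proposition (validity of Particle-MALA).** Let $D\ge 0$, $T\ge 1$, $N\ge 1$, $\mathcal X=\mathbb R^D$, $[N]_0=\{0,\dots,N\}$. Let $Q_1\colon\mathcal X\to(0,\infty)$ and $Q_t\colon\mathcal X\times\mathcal X\to(0,\infty)$ ($2\le t\le T$) be differentiable, write $Q_1(x_{0:1})=Q_1(x_1)$, and assume that $\prod_{t=1}^T Q_t(x_{t-1:t})$ is Lebesgue integrable over $\mathcal X^T$. Let $\pi_T$ be the probability measure on $\mathcal X^T$ with density proportional to $\prod_{t=1}^T Q_t(x_{t-1:t})$, and for $t\le T$ let $\pi_t(x_{1:t})\propto\prod_{s=1}^t Q_s(x_{s-1:s})$ be the filter densities (normalising constants are irrelevant below). Let $\kappa\in\{0,1\}$, $\delta_1,\dots,\delta_T>0$, and $$\log H_{t,\phi}(x,\bar x)=\tfrac1{\delta_t}\bigl[2\phi^{\mathsf T}(\bar x-x)-\tfrac N{N+1}\phi^{\mathsf T}\phi\bigr].$$ Given $x_{1:T}\in\mathcal X^T$, one iteration of Particle-MALA generates $x'_{1:T}$ as follows. 1. For $t=1,\dots,T$: (a) sample $k_t$ uniformly from $[N]_0$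 and set $x_t^{k_t}:=x_t$; (b) if $t>1$, set $a_{t-1}^{k_t}:=k_{t-1}$ and, independently for $n\neq k_t$, set $a_{t-1}^n:=i$ with probability $W_{t-1}^i$; (c) sample $u_t\sim\mathrm N\bigl(x_t+\kappa\tfrac{\delta_t}2\nabla_{x_t}\log\pi_t(x_{1:t}),\tfrac{\delta_t}2 I\bigr)$ and then, independently for $n\ne k_t$, $x_t^n\sim\mathrm N(u_t,\tfrac{\delta_t}2 I)$; (d) set $\bar x_t:=\frac1{N+1}\sum_{n=0}^N x_t^n$ and, for $n\in[N]_0$, with $x_{t-1:t}^{(n)}:=(x_{t-1}^{a_{t-1}^n},x_t^n)$, $$w_t^n:=Q_t(x_{t-1:t}^{(n)})\,H_{t,\phi_t^n}(x_t^n,\bar x_t),\qquad \phi_t^n:=\kappa\tfrac{\delta_t}2\nabla_{x_t^n}\log Q_t(x_{t-1:t}^{(n)});$$ (e) set $W_t^n:=w_t^n/\sum_{m=0}^N w_t^m$. 2. Sample $i\in[N]_0\setminus\{k_T\}$ with probability $W_T^i/(1-W_T^{k_T})$; set $l_T:=i$ with probability $\min\{1,(1-W_T^{k_T})/(1-W_T^i)\}$,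 and $l_T:=k_T$ otherwise. 3. For $t=T-1,\dots,1$, sample $l_t=i\in[N]_0$ with probability $W_t^iQ_{t+1}(x_t^i,x_{t+1}^{l_{t+1}})\big/\sum_{n=0}^N W_t^nQ_{t+1}(x_t^n,x_{t+1}^{l_{t+1}})$. 4. Return $x'_{1:T}:=(x_1^{l_1},\dots,x_T^{l_T})$. Then the conditional law of $x'_{1:T}$ given $x_{1:T}$ is a Markov kernel on $\mathcal X^T$, and this kernel leaves $\pi_T$ invariant. -/

import Mathlib

open MeasureTheory ProbabilityTheory

noncomputable section

namespace ParticleMALA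

/-- The state space `ℝ^D` with its Euclidean structure. -/
abbrev State (D : ℕ) : Type := EuclideanSpace ℝ (Fin D)

section Target

variable {D m : ℕ}

/-- The unnormalised joint smoothing density `∏_{t=1}^T Q_t(x_{t-1:t})` for `T = m + 1` time steps.
Here `Q₁ x₁` is the first factor and `Q i` is the factor linking the `i`-th and the `(i+1)`-st
entries of the path (counted from `0`), that is `Q i = Q_{i+2}` in terms of times `1, …, T`. -/
def pathDensity (Q₁ : State D → ℝ) (Q : Fin m → State D → State D → ℝ)
    (x : Fin (m + 1) → State D) : ℝ :=
  Q₁ (x 0) * ∏ i : Fin m, Q i (x i.castSucc) (x i.succ)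

/-- The joint smoothing distribution `π_T`: the measure on paths whose Lebesgue density is
proportional to `pathDensity`, normalised to have mass one. -/
def smoothing (Q₁ : State D → ℝ) (Q : Fin m → State D → State D → ℝ) :
    Measure (Fin (m + 1) → State D) :=
  (∫⁻ x, ENNReal.ofReal (pathDensity Q₁ Q x))⁻¹ •
    (volume : Measure (Fin (m + 1) → State D)).withDensity
      (fun x => ENNReal.ofReal (pathDensity Q₁ Q x))

end Target

section Sampling

variable {D N : ℕ}

/-- Sampling an index `i` with probability `p i`. -/
def categorical (p : Fin (N + 1) → ℝ) : Measure (Fin (N + 1)) :=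
  ∑ i, ENNReal.ofReal (p i) • Measure.dirac i

/-- Normalisation of weights, `W^n = w^n / ∑_m w^m`. -/
def normalise (w : Fin (N + 1) → ℝ) (n : Fin (N + 1)) : ℝ :=
  w n / ∑ j, w j

/-- Sampling an index uniformly from `{0, …, N}`. -/
def uniformIndex (N : ℕ) : Measure (Fin (N + 1)) :=
  categorical (fun _ => 1 / ((N : ℝ) + 1))

/-- Sampling the ancestor indices: the ancestor of the reference position `k'` is the previous
reference position `k`; the other ancestors are independent draws from the weights `W`. -/
def ancestors (W : Fin (N + 1) → ℝ) (k k' : Fin (N + 1)) :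
    Measure (Fin (N + 1) → Fin (N + 1)) :=
  Measure.pi (fun n => if n = k' then Measure.dirac k else categorical W)

/-- The isotropic Gaussian distribution `N(μ, s I)` on `ℝ^D`. -/
def isoGaussian (μ : State D) (s : ℝ) : Measure (State D) :=
  multivariateGaussian μ (s • (1 : Matrix (Fin D) (Fin D) ℝ))

/-- The gradient drift `κ (δ/2) ∇ log f (x)`. -/
def drift (κ δ : ℝ) (f : State D → ℝ) (x : State D) : State D :=
  (κ * (δ / 2)) • gradient (fun y => Real.log (f y)) x

/-- The particle proposal at one time step. With `x` the current entry of the reference path, `k` its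
position among the particles, and `γ` the (unnormalised) filter density `π_t(x_{1:t-1}, ·)` along
the reference path as a function of its last argument: put `x` at position `k`, sample
`u ∼ N(x + κ (δ/2) ∇ log γ(x), (δ/2) I)`, and then sample all other particles independently from
`N(u, (δ/2) I)`. The normalising constant of the filter does not affect the gradient. -/
def propose (κ δ : ℝ) (γ : State D → ℝ) (x : State D) (k : Fin (N + 1)) :
    Measure (Fin (N + 1) → State D) :=
  (isoGaussian (x + drift κ δ γ x) (δ / 2)).bind fun u =>
    Measure.pi (fun n => if n = k then Measure.dirac x else isoGaussian u (δ / 2))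

/-- The weight factor `H_φ(x, x̄) = exp ((1/δ) (2 φᵀ (x̄ - x) - N/(N+1) φᵀ φ))`. -/
def weightFactor (N : ℕ) (δ : ℝ) (φ x xbar : State D) : ℝ :=
  Real.exp (1 / δ * (2 * inner ℝ φ (xbar - x) - (N : ℝ) / ((N : ℝ) + 1) * inner ℝ φ φ))

/-- The mean `x̄ = (1/(N+1)) ∑_n x^n` of the particles. -/
def particleMean (X : Fin (N + 1) → State D) : State D :=
  (1 / ((N : ℝ) + 1)) • ∑ n, X n

/-- The unnormalised weight of the `n`-th particle. Here `q n` is the function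
`y ↦ Q_t(x_{t-1}^{a_{t-1}^n}, y)` (and `Q_1` at the first time step). -/
def weight (κ δ : ℝ) (q : Fin (N + 1) → State D → ℝ) (X : Fin (N + 1) → State D)
    (n : Fin (N + 1)) : ℝ :=
  q n (X n) * weightFactor N δ (drift κ δ (q n) (X n)) (X n) (particleMean X)

/-- The final index `l_T` (forced move): sample `i ≠ k` with probability `W^i / (1 - W^k)`, return
`i` with probability `min 1 ((1 - W^k) / (1 - W^i))`, and return `k` otherwise. -/
def forcedMove (W : Fin (N + 1) → ℝ) (k : Fin (N + 1)) : Measure (Fin (N + 1)) :=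
  (categorical (fun i => if i = k then 0 else W i / (1 - W k))).bind fun i =>
    ENNReal.ofReal (min 1 ((1 - W k) / (1 - W i))) • Measure.dirac i +
      ENNReal.ofReal (1 - min 1 ((1 - W k) / (1 - W i))) • Measure.dirac k

/-- The backward index `l_t`: sample `i` with probability `W^i q^i / ∑_n W^n q^n`, where
`q i` is the value `Q_{t+1}(x_t^i, x_{t+1}^{l_{t+1}})`. -/
def backwardIndex (W q : Fin (N + 1) → ℝ) : Measure (Fin (N + 1)) :=
  categorical (fun i => W i * q i / ∑ n, W n * q n)

/-- The remainder of the algorithm once the particles `X`, their normalised weights `W` and the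
reference position `k` at some time `t` have been generated, as the law of the output
`(x_t^{l_t}, …, x_T^{l_T})`, with `m = T - t` time steps to go. The arguments `Q`, `δ` are the
factors `Q_{t+1}, …, Q_T` and the step sizes `δ_{t+1}, …, δ_T`, `x` is the reference path
`x_{t:T}`, and `γ` is the value `∏_{s ≤ t} Q_s(x_{s-1:s})` of the unnormalised filter density at
the reference path `x_{1:t}`.

If `t = T`, only the final index is left to sample. Otherwise, the particle system is first moved
to time `t + 1`, then the remainder of the algorithm from time `t + 1` is run, which returns
`y = (x_{t+1}^{l_{t+1}}, …, x_T^{l_T})`, and finally `l_t` is sampled by backward sampling. -/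
def remainder (κ : ℝ) : (m : ℕ) → (Q : Fin m → State D → State D → ℝ) → (δ : Fin m → ℝ) →
    (x : Fin (m + 1) → State D) → (γ : ℝ) → (k : Fin (N + 1)) → (X : Fin (N + 1) → State D) →
    (W : Fin (N + 1) → ℝ) → Measure (Fin (m + 1) → State D)
  | 0, _, _, _, _, k, X, W => (forcedMove W k).map (fun l => fun _ => X l)
  | m + 1, Q, δ, x, γ, k, X, W =>
      (uniformIndex N).bind fun k' =>
      (ancestors W k k').bind fun a =>
      (propose κ (δ 0) (fun y => γ * Q 0 (x 0) y) (x 1) k').bind fun X' =>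
      (remainder κ m (fun i => Q i.succ) (fun i => δ i.succ) (fun i => x i.succ)
        (γ * Q 0 (x 0) (x 1)) k' X'
        (normalise (weight κ (δ 0) (fun n => Q 0 (X (a n))) X'))).bind fun y =>
      (backwardIndex W (fun i => Q 0 (X i) (y 0))).map
        (fun l => (Fin.cons (X l) y : Fin (m + 2) → State D))

/-- One iteration of Particle-MALA with `N + 1` particles over `T = m + 1` time steps: the law of
the new path given the reference path `x`. Here `δ` lists the step sizes `δ_1, …, δ_T`. -/
def particleMALA (N : ℕ) (κ : ℝ) {m : ℕ} (δ : Fin (m + 1) → ℝ) (Q₁ : State D → ℝ)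
    (Q : Fin m → State D → State D → ℝ) (x : Fin (m + 1) → State D) :
    Measure (Fin (m + 1) → State D) :=
  (uniformIndex N).bind fun k =>
  (propose κ (δ 0) Q₁ (x 0) k).bind fun X =>
  remainder κ m Q (fun i => δ i.succ) x (Q₁ (x 0)) k X
    (normalise (weight κ (δ 0) (fun _ => Q₁) X))

end Sampling

end ParticleMALA

end

namespace ParticleMALA

open scoped ENNReal

/-! ### Measures: binding, finite sums, finite products -/

section General

variable {α β γ : Type*} [MeasurableSpace α] [MeasurableSpace β] [MeasurableSpace γ]

/-! The heart of the proof is a symmetry at one time step. Weight the reference point `x^k` by its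
density `q^k`, draw `u` around `x^k + φ^k` and the other particles around `u`. Integrating out `u`
and completing the square gives a joint density of all particles equal to a factor symmetric in the
particles times `q^k H_{φ^k}(x^k, x̄) = w^k` (`lintegral_tilted_gaussian`,
`lintegral_reference_propose`). So `H` compensates exactly for the asymmetry caused by the drift,
and when `k` is uniform its conditional law given the particles is `W`. Two functionals of `k` and
the particles with the same `W`-average may therefore be exchanged (`sum_lintegral_propose_congr`).

Time is handled by induction on the number of remaining steps (`remainder_invariant`). Fix the
particles `X` and weights `W`, draw the reference position from `W`, and weight the rest of the
reference path by the product of the transition densities; the claim is that the remainder of the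
algorithm preserves this measure. With no step left, this is reversibility of the forced move with
respect to `W` (`forcedMove_detailed_balance`). Otherwise, a reference position drawn from `W` and
used as the ancestor of the next reference position makes all ancestors independent draws from `W`
(`sum_mul_ancestors`). For fixed ancestors, the one-step symmetry reduces the claim to the induction
hypothesis at the new particles, with the backward draw absorbed into the test function. What
remains is that the backward draw has the conditional law of the position given the path after it
(`sum_mul_lintegral_backwardStep`). The same symmetry with `Q₁` at time one gives the theorem.

The gradient of the log filter density involves only its last factor, the earlier ones being
positive constants in the current point (`remainder_eq_one`); hence the reference drift agrees with
the drift in the weights. -/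

lemma measurable_bind_of_isProbabilityMeasure {μ : α → Measure β} {f : α → β → Measure γ}
    (hμ : Measurable μ) (hμp : ∀ a, IsProbabilityMeasure (μ a))
    (hf : Measurable (Function.uncurry f)) : Measurable fun a => (μ a).bind (f a) := by
  refine Measure.measurable_of_measurable_coe _ fun s hs => ?_
  let κ : Kernel α β := ⟨μ, hμ⟩
  have : IsMarkovKernel κ := ⟨hμp⟩
  have h : ∀ a, (μ a).bind (f a) s = ∫⁻ b, f a b s ∂κ a := fun a =>
    Measure.bind_apply hs (hf.comp measurable_prodMk_left).aemeasurable
  simp_rw [h]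
  exact Measurable.lintegral_kernel_prod_right ((Measure.measurable_coe hs).comp hf)

lemma isProbabilityMeasure_bind {μ : Measure β} [IsProbabilityMeasure μ] {f : β → Measure γ}
    (hf : Measurable f) (hfp : ∀ b, IsProbabilityMeasure (f b)) :
    IsProbabilityMeasure (μ.bind f) :=
  ⟨by rw [Measure.bind_apply .univ hf.aemeasurable]; simp⟩

lemma lintegral_bind_of_finite {ι : Type*} [Fintype ι] [MeasurableSpace ι]
    [MeasurableSingletonClass ι] {μ : Measure ι} (f : ι → Measure γ) {g : γ → ℝ≥0∞}
    (hg : Measurable g) :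
    ∫⁻ y, g y ∂μ.bind f = ∑ i, μ {i} * ∫⁻ y, g y ∂f i := by
  rw [Measure.lintegral_bind (measurable_of_finite f).aemeasurable hg.aemeasurable,
    lintegral_fintype]
  simp_rw [mul_comm]

lemma bind_of_finite {ι : Type*} [Fintype ι] [MeasurableSpace ι]
    [MeasurableSingletonClass ι] (μ : Measure ι) (f : ι → Measure γ) :
    μ.bind f = ∑ i, μ {i} • f i := by
  refine Measure.ext_of_lintegral _ fun g hg => ?_
  rw [lintegral_bind_of_finite f hg, lintegral_finsetSum_measure]
  simp

lemma measurable_finset_sum_smul {ι : Type*} (s : Finset ι) {c : ι → α → ℝ≥0∞}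
    {μ : ι → α → Measure β} (hc : ∀ i ∈ s, Measurable (c i)) (hμ : ∀ i ∈ s, Measurable (μ i)) :
    Measurable fun a => ∑ i ∈ s, c i a • μ i a := by
  refine Measure.measurable_of_measurable_coe _ fun t ht => ?_
  simp only [Measure.coe_finsetSum, Finset.sum_apply, Measure.smul_apply, smul_eq_mul]
  exact Finset.measurable_sum s fun i hi =>
    (hc i hi).mul ((Measure.measurable_coe ht).comp (hμ i hi))

/-- Used to isolate the coordinate at the reference position `k`, wherever it sits. -/
lemma lintegral_pi_insertNth {n : ℕ} (μ : Fin (n + 1) → Measure α) (hμ : ∀ i, SigmaFinite (μ i))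
    (k : Fin (n + 1)) {F : (Fin (n + 1) → α) → ℝ≥0∞} (hF : Measurable F) :
    ∫⁻ X, F X ∂Measure.pi μ =
      ∫⁻ x, ∫⁻ y, F (k.insertNth x y) ∂(Measure.pi fun j => μ (k.succAbove j)) ∂μ k := by
  have h := (measurePreserving_piFinSuccAbove μ k).symm
  rw [← h.lintegral_comp hF, lintegral_prod]
  · rfl
  · exact (hF.comp h.measurable).aemeasurable

@[fun_prop]
lemma measurable_insertNth {n : ℕ} (k : Fin (n + 1)) {f : β → α} {g : β → Fin n → α}
    (hf : Measurable f) (hg : Measurable g) :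
    Measurable fun b => (k.insertNth (f b) (g b) : Fin (n + 1) → α) :=
  (MeasurableEquiv.piFinSuccAbove (fun _ : Fin (n + 1) => α) k).symm.measurable.comp
    (hf.prodMk hg)

lemma measurable_comp₂ {δ : Type*} [MeasurableSpace δ] {F : α → β → γ}
    (hF : Measurable (Function.uncurry F)) {f : δ → α} {g : δ → β}
    (hf : Measurable f) (hg : Measurable g) : Measurable fun d => F (f d) (g d) :=
  hF.comp (hf.prodMk hg)

lemma lintegral_pi_cons {n : ℕ} (μ : Measure α) [SigmaFinite μ]
    {F : (Fin (n + 1) → α) → ℝ≥0∞} (hF : Measurable F) :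
    ∫⁻ X, F X ∂Measure.pi (fun _ => μ) =
      ∫⁻ x, ∫⁻ y, F (Fin.cons x y) ∂(Measure.pi fun _ : Fin n => μ) ∂μ := by
  rw [lintegral_pi_insertNth (fun _ => μ) inferInstance 0 hF]
  simp_rw [Fin.insertNth_zero']

lemma lintegral_pi_prod {n : ℕ} (μ : Fin n → Measure α) (hμ : ∀ i, SigmaFinite (μ i))
    {f : Fin n → α → ℝ≥0∞} (hf : ∀ i, Measurable (f i)) :
    ∫⁻ X, ∏ i, f i (X i) ∂Measure.pi μ = ∏ i, ∫⁻ x, f i x ∂μ i := by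
  induction n with
  | zero => simp
  | succ n ih =>
    have hm : Measurable fun X : Fin (n + 1) → α => ∏ i, f i (X i) :=
      Finset.measurable_prod _ fun i _ => (hf i).comp (measurable_pi_apply i)
    have hm' : Measurable fun y : Fin n → α => ∏ i : Fin n, f i.succ (y i) :=
      Finset.measurable_prod _ fun i _ => (hf _).comp (measurable_pi_apply i)
    rw [lintegral_pi_insertNth μ hμ 0 hm, Fin.prod_univ_succ]
    simp only [Fin.insertNth_zero', Fin.prod_univ_succ, Fin.cons_zero, Fin.cons_succ,
      Fin.zero_succAbove]
    simp_rw [lintegral_const_mul _ hm']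
    rw [lintegral_mul_const _ (hf 0), ih _ (fun i => hμ _) (fun i => hf _)]

lemma pi_withDensity {n : ℕ} (μ : Fin n → Measure α) (hμ : ∀ i, SigmaFinite (μ i))
    {f : Fin n → α → ℝ≥0∞} (hf : ∀ i, Measurable (f i))
    (hfμ : ∀ i, SigmaFinite ((μ i).withDensity (f i))) :
    Measure.pi (fun i => (μ i).withDensity (f i)) =
      (Measure.pi μ).withDensity fun X => ∏ i, f i (X i) := by
  refine Measure.pi_eq fun s hs => ?_
  rw [withDensity_apply _ (MeasurableSet.univ_pi hs), ← lintegral_indicator (.univ_pi hs)]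
  -- The indicator of a box factorises, so the integral over a box becomes a product of
  -- one-coordinate integrals.
  have h : (Set.univ.pi s).indicator (fun X : Fin n → α => ∏ i, f i (X i)) =
      fun X => ∏ i, (s i).indicator (f i) (X i) := by
    ext X
    by_cases hX : X ∈ Set.univ.pi s
    · rw [Set.indicator_of_mem hX]
      exact Finset.prod_congr rfl fun i _ =>
        (Set.indicator_of_mem (hX i (Set.mem_univ i)) _).symm
    · rw [Set.indicator_of_notMem hX]
      obtain ⟨i, hi⟩ : ∃ i, X i ∉ s i := by simpa using hX
      exact (Finset.prod_eq_zero (Finset.mem_univ i) (Set.indicator_of_notMem hi _)).symm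
  rw [h, lintegral_pi_prod μ hμ fun i => (hf i).indicator (hs i)]
  exact Finset.prod_congr rfl fun i _ => by
    rw [lintegral_indicator (hs i), withDensity_apply _ (hs i)]

end General

/-! ### Isotropic Gaussians and their densities -/

section Gaussian

variable {D : ℕ}

/-- The Lebesgue density of the centred isotropic Gaussian distribution with variance `s`. -/
noncomputable def gaussianDensity (s : ℝ) (z : State D) : ℝ≥0∞ :=
  ENNReal.ofReal ((√(2 * Real.pi * s))⁻¹ ^ D * Real.exp (-‖z‖ ^ 2 / (2 * s)))

@[fun_prop]
lemma measurable_gaussianDensity (s : ℝ) : Measurable (gaussianDensity (D := D) s) := by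
  unfold gaussianDensity; fun_prop

instance (μ : State D) (s : ℝ) : IsProbabilityMeasure (isoGaussian μ s) := by
  unfold isoGaussian; infer_instance

/-- The characteristic functions agree, because the covariance is diagonal and the exponent splits
over coordinates. -/
lemma isoGaussian_eq_map_pi (μ : State D) {s : ℝ} (hs : 0 < s) :
    isoGaussian μ s =
      (Measure.pi fun i => gaussianReal (μ i) s.toNNReal).map (WithLp.toLp 2) := by
  refine Measure.ext_of_charFun (E := State D) ?_
  ext t
  rw [isoGaussian, charFun_multivariateGaussian (Matrix.PosSemidef.one.smul hs.le)]
  simp_rw [charFun_pi, charFun_gaussianReal, ← Complex.exp_sum]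
  congr 1
  simp [PiLp.inner_apply, Finset.sum_sub_distrib, Matrix.smul_mulVec, dotProduct,
    Finset.sum_div, Finset.mul_sum, hs.le, mul_comm, mul_left_comm, pow_two]

/-- The product of the one-dimensional densities is transported along `WithLp.toLp 2`, which
preserves volume. -/
lemma isoGaussian_eq_withDensity (μ : State D) {s : ℝ} (hs : 0 < s) :
    isoGaussian μ s = volume.withDensity fun x => gaussianDensity s (x - μ) := by
  have hs' : s.toNNReal ≠ 0 := by simpa using hs
  have hg : ∀ i, gaussianReal (μ i) s.toNNReal =
      volume.withDensity (gaussianPDF (μ i) s.toNNReal) :=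
    fun i => gaussianReal_of_var_ne_zero _ hs'
  have hd : Measurable fun x : State D => gaussianDensity s (x - μ) :=
    (measurable_gaussianDensity s).comp (by fun_prop)
  rw [isoGaussian_eq_map_pi μ hs]
  simp_rw [hg]
  rw [pi_withDensity _ (fun _ => inferInstance) (fun i => measurable_gaussianPDF _ _)
    (fun i => by rw [← hg]; infer_instance)]
  refine Measure.ext_of_lintegral _ fun f hf => ?_
  have hp : Measurable fun X : Fin D → ℝ => ∏ i, gaussianPDF (μ i) s.toNNReal (X i) :=
    Finset.measurable_prod _ fun i _ => (measurable_gaussianPDF _ _).comp (measurable_pi_apply i)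
  have hf' : Measurable fun X : Fin D → ℝ => f (WithLp.toLp 2 X) := hf.comp (by fun_prop)
  rw [lintegral_map hf (by fun_prop), lintegral_withDensity_eq_lintegral_mul _ hp hf',
    lintegral_withDensity_eq_lintegral_mul _ hd hf,
    ← (PiLp.volume_preserving_toLp (Fin D)).lintegral_comp (hd.mul hf)]
  refine lintegral_congr fun x => ?_
  simp only [Pi.mul_apply]
  congr 1
  simp only [gaussianPDF, gaussianDensity, gaussianPDFReal]
  rw [← ENNReal.ofReal_prod_of_nonneg fun i _ => by positivity, Finset.prod_mul_distrib,
    ← Real.exp_sum]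
  simp [EuclideanSpace.real_norm_sq_eq, Finset.sum_div, hs.le, neg_div]

lemma lintegral_isoGaussian (μ : State D) {s : ℝ} (hs : 0 < s) {f : State D → ℝ≥0∞}
    (hf : Measurable f) :
    ∫⁻ x, f x ∂isoGaussian μ s = ∫⁻ x, gaussianDensity s (x - μ) * f x := by
  have hd : Measurable fun x : State D => gaussianDensity s (x - μ) :=
    (measurable_gaussianDensity s).comp (by fun_prop)
  rw [isoGaussian_eq_withDensity μ hs, lintegral_withDensity_eq_lintegral_mul _ hd hf]
  rfl

lemma measurable_isoGaussian {s : ℝ} (hs : 0 < s) :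
    Measurable fun μ : State D => isoGaussian μ s := by
  refine Measure.measurable_of_measurable_coe _ fun A hA => ?_
  simp_rw [isoGaussian_eq_withDensity _ hs, withDensity_apply _ hA]
  have h : Measurable fun p : State D × State D => gaussianDensity s (p.2 - p.1) :=
    (measurable_gaussianDensity s).comp (by fun_prop)
  exact h.lintegral_prod_right'

end Gaussian

/-! ### The particle proposal and its symmetry -/

section Proposal

variable {D N : ℕ}

/-- Independent draws from `N(u, s I)`, with the `k`-th entry replaced by `x`. -/
noncomputable def pinnedGaussian (s : ℝ) (x : State D) (k : Fin (N + 1)) (u : State D) :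
    Measure (Fin (N + 1) → State D) :=
  Measure.pi (fun n => if n = k then Measure.dirac x else isoGaussian u s)

lemma isProbabilityMeasure_pinned (s : ℝ) (x : State D) (k : Fin (N + 1)) (u : State D)
    (n : Fin (N + 1)) :
    IsProbabilityMeasure (if n = k then Measure.dirac x else isoGaussian u s) := by
  split_ifs <;> infer_instance

instance (s : ℝ) (x : State D) (k : Fin (N + 1)) (u : State D) :
    IsProbabilityMeasure (pinnedGaussian s x k u) := by
  have := isProbabilityMeasure_pinned s x k u
  unfold pinnedGaussian
  infer_instance

lemma lintegral_pinnedGaussian {s : ℝ} (hs : 0 < s) (x : State D) (k : Fin (N + 1)) (u : State D)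
    {F : (Fin (N + 1) → State D) → ℝ≥0∞} (hF : Measurable F) :
    ∫⁻ X, F X ∂pinnedGaussian s x k u =
      ∫⁻ y : Fin N → State D, (∏ j, gaussianDensity s (y j - u)) * F (k.insertNth x y) := by
  have hp := isProbabilityMeasure_pinned s x k u
  have hFm : Measurable fun p : State D × (Fin N → State D) => F (k.insertNth p.1 p.2) :=
    by fun_prop
  have hd : Measurable fun z : State D => gaussianDensity s (z - u) := by fun_prop
  have hD : Measurable fun y : Fin N → State D => ∏ j, gaussianDensity s (y j - u) := by fun_prop
  have hFx : Measurable fun y : Fin N → State D => F (k.insertNth x y) := by fun_prop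
  rw [pinnedGaussian, lintegral_pi_insertNth _ (fun _ => inferInstance) k hF]
  simp only [if_true, Fin.succAbove_ne, if_false]
  rw [lintegral_dirac' _ hFm.lintegral_prod_right']
  have h : (Measure.pi fun _ : Fin N => isoGaussian u s) =
      (volume : Measure (Fin N → State D)).withDensity
        fun y => ∏ j, gaussianDensity s (y j - u) := by
    have hu := isoGaussian_eq_withDensity u hs
    simp_rw [hu]
    exact pi_withDensity _ (fun _ => inferInstance) (fun _ => hd)
      (fun _ => by rw [← hu]; infer_instance)
  rw [h, lintegral_withDensity_eq_lintegral_mul _ hD hFx]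
  rfl

lemma measurable_pinnedGaussian {s : ℝ} (hs : 0 < s) (k : Fin (N + 1)) :
    Measurable fun p : State D × State D => pinnedGaussian s p.1 k p.2 := by
  refine Measure.measurable_of_measurable_coe _ fun A hA => ?_
  simp_rw [← lintegral_indicator_one hA]
  have h1 : Measurable (A.indicator (1 : (Fin (N + 1) → State D) → ℝ≥0∞)) :=
    measurable_one.indicator hA
  simp_rw [lintegral_pinnedGaussian hs _ k _ h1]
  have h : Measurable fun q : (State D × State D) × (Fin N → State D) =>
      (∏ j, gaussianDensity s (q.2 j - q.1.2)) *
        A.indicator (1 : (Fin (N + 1) → State D) → ℝ≥0∞) (k.insertNth q.1.1 q.2) := by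
    fun_prop
  exact h.lintegral_prod_right'

lemma measurable_pinnedGaussian_mean {s : ℝ} (hs : 0 < s) (x : State D) (k : Fin (N + 1)) :
    Measurable fun u => pinnedGaussian s x k u :=
  (measurable_pinnedGaussian hs k).comp (f := fun u => (x, u)) (by fun_prop)

lemma propose_eq (κ δ : ℝ) (γ : State D → ℝ) (x : State D) (k : Fin (N + 1)) :
    propose κ δ γ x k =
      (isoGaussian (x + drift κ δ γ x) (δ / 2)).bind (pinnedGaussian (δ / 2) x k) :=
  rfl

lemma isProbabilityMeasure_propose (κ : ℝ) {δ : ℝ} (hδ : 0 < δ) (γ : State D → ℝ) (x : State D)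
    (k : Fin (N + 1)) : IsProbabilityMeasure (propose κ δ γ x k) :=
  isProbabilityMeasure_bind (measurable_pinnedGaussian_mean (half_pos hδ) x k)
    fun _ => inferInstance

lemma measurable_propose {α : Type*} [MeasurableSpace α] (κ : ℝ) {δ : ℝ} (hδ : 0 < δ)
    {γ : α → State D → ℝ} {x : α → State D} (hx : Measurable x)
    (hd : Measurable fun a => drift κ δ (γ a) (x a)) (k : Fin (N + 1)) :
    Measurable fun a => propose κ δ (γ a) (x a) k := by
  refine measurable_bind_of_isProbabilityMeasure
    (f := fun a u => pinnedGaussian (δ / 2) (x a) k u)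
    ((measurable_isoGaussian (half_pos hδ)).comp (hx.add hd)) (fun _ => inferInstance) ?_
  exact (measurable_pinnedGaussian (half_pos hδ) k).comp
    (f := fun p : α × State D => (x p.1, p.2)) (by fun_prop)

/-- Tonelli moves the integral over the auxiliary variable `u` inside, leaving an explicit density
for the non-reference particles. -/
lemma lintegral_propose (κ : ℝ) {δ : ℝ} (hδ : 0 < δ) (γ : State D → ℝ) (x : State D)
    (k : Fin (N + 1)) {F : (Fin (N + 1) → State D) → ℝ≥0∞} (hF : Measurable F) :
    ∫⁻ X, F X ∂propose κ δ γ x k =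
      ∫⁻ y : Fin N → State D,
        (∫⁻ u, gaussianDensity (δ / 2) (u - (x + drift κ δ γ x)) *
          ∏ j, gaussianDensity (δ / 2) (y j - u)) * F (k.insertNth x y) := by
  have hs := half_pos hδ
  rw [propose_eq, Measure.lintegral_bind (measurable_pinnedGaussian_mean hs x k).aemeasurable
    hF.aemeasurable]
  simp_rw [lintegral_pinnedGaussian hs x k _ hF]
  have hm : Measurable fun p : State D × (Fin N → State D) =>
      (∏ j, gaussianDensity (δ / 2) (p.2 j - p.1)) * F (k.insertNth x p.2) := by
    fun_prop
  rw [lintegral_isoGaussian _ hs hm.lintegral_prod_right']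
  have h1 : ∀ u : State D, gaussianDensity (δ / 2) (u - (x + drift κ δ γ x)) *
      ∫⁻ y : Fin N → State D, (∏ j, gaussianDensity (δ / 2) (y j - u)) * F (k.insertNth x y) =
      ∫⁻ y : Fin N → State D, gaussianDensity (δ / 2) (u - (x + drift κ δ γ x)) *
        ((∏ j, gaussianDensity (δ / 2) (y j - u)) * F (k.insertNth x y)) := fun u =>
    (lintegral_const_mul _ (by fun_prop)).symm
  simp_rw [h1]
  have hm' : Measurable fun p : State D × (Fin N → State D) =>
      gaussianDensity (δ / 2) (p.1 - (x + drift κ δ γ x)) *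
        ((∏ j, gaussianDensity (δ / 2) (p.2 j - p.1)) * F (k.insertNth x p.2)) := by
    fun_prop
  rw [lintegral_lintegral_swap hm'.aemeasurable]
  refine lintegral_congr fun y => ?_
  rw [← lintegral_mul_const]
  · simp_rw [mul_assoc]
  · fun_prop

/-- The integral over the auxiliary variable `u` of the joint density of all particles given `u`;
it is a symmetric function of the particles. -/
noncomputable def marginalDensity (s : ℝ) (X : Fin (N + 1) → State D) : ℝ≥0∞ :=
  ∫⁻ u, ∏ n, gaussianDensity s (X n - u)

lemma measurable_marginalDensity (s : ℝ) :
    Measurable (marginalDensity (D := D) (N := N) s) := by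
  have h : Measurable fun p : (Fin (N + 1) → State D) × State D =>
      ∏ n, gaussianDensity s (p.1 n - p.2) := by
    fun_prop
  exact h.lintegral_prod_right'

/-- Completing the square. Write `w = v + φ/(N+1)`. Summing `‖X n - w‖²` over all `n` produces the
cross term `-2⟨φ, x̄ - v⟩`, and replacing `X k` by `X k + φ` produces `2⟨φ, X k - v⟩`. In their sum
`v` cancels, and the coefficient of `⟨φ, φ⟩` is `1/(N+1) - 2/(N+1) + 1 = N/(N+1)`. -/
lemma quadratic_identity (X : Fin (N + 1) → State D) (k : Fin (N + 1)) (φ v : State D) :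
    ‖(v + (1 / ((N : ℝ) + 1)) • φ) - (X k + φ)‖ ^ 2 +
        ∑ j, ‖X (k.succAbove j) - (v + (1 / ((N : ℝ) + 1)) • φ)‖ ^ 2 =
      ∑ n, ‖X n - v‖ ^ 2 - (2 * inner ℝ φ (particleMean X - X k)
        - (N : ℝ) / ((N : ℝ) + 1) * inner ℝ φ φ) := by
  have hN : (N : ℝ) + 1 ≠ 0 := by positivity
  set w : State D := v + (1 / ((N : ℝ) + 1)) • φ with hw
  have hk : ‖w - (X k + φ)‖ ^ 2 =
      ‖X k - w‖ ^ 2 + 2 * inner ℝ φ (X k - w) + inner ℝ φ φ := by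
    rw [norm_sub_rev, show X k + φ - w = (X k - w) + φ by abel, norm_add_sq_real,
      real_inner_comm, real_inner_self_eq_norm_sq]
  have hn : ∀ n, ‖X n - w‖ ^ 2 = ‖X n - v‖ ^ 2
      - 2 / ((N : ℝ) + 1) * inner ℝ φ (X n - v)
      + 1 / ((N : ℝ) + 1) ^ 2 * inner ℝ φ φ := fun n => by
    rw [hw, ← sub_sub, norm_sub_sq_real, norm_smul, inner_smul_right, real_inner_comm,
      real_inner_self_eq_norm_sq, mul_pow, Real.norm_eq_abs, sq_abs]
    field_simp
  have hm : ∑ n, inner ℝ φ (X n - v) = ((N : ℝ) + 1) * inner ℝ φ (particleMean X - v) := by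
    rw [← inner_sum, Finset.sum_sub_distrib, particleMean, inner_sub_right, inner_sub_right,
      inner_smul_right]
    simp [← Nat.cast_smul_eq_nsmul ℝ, inner_smul_right]
    field_simp
  have hs : ∑ n, ‖X n - w‖ ^ 2 = ∑ n, ‖X n - v‖ ^ 2 - 2 * inner ℝ φ (particleMean X - v)
      + 1 / ((N : ℝ) + 1) * inner ℝ φ φ := by
    simp_rw [hn, Finset.sum_add_distrib, Finset.sum_sub_distrib, ← Finset.mul_sum, hm]
    simp
    field_simp
  rw [Fin.sum_univ_succAbove _ k] at hs
  rw [hk]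
  have e1 : inner ℝ φ (X k - w) = inner ℝ φ (X k - v) - 1 / ((N : ℝ) + 1) * inner ℝ φ φ := by
    rw [hw, ← sub_sub, inner_sub_right, inner_smul_right]
  have e2 : inner ℝ φ (particleMean X - X k) =
      inner ℝ φ (particleMean X - v) - inner ℝ φ (X k - v) := by
    rw [← inner_sub_right]; congr 1; abel
  have e3 : (N : ℝ) / ((N : ℝ) + 1) = 1 - 1 / ((N : ℝ) + 1) := by field_simp; ring
  rw [e1, e2, e3]
  linear_combination hs

/-- This is where the form of `H` comes from: it is the only trace of `k` and `φ` once `u` is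
integrated out. -/
lemma lintegral_tilted_gaussian {δ : ℝ} (hδ : 0 < δ) (X : Fin (N + 1) → State D)
    (k : Fin (N + 1)) (φ : State D) :
    ∫⁻ u, gaussianDensity (δ / 2) (u - (X k + φ)) *
        ∏ j, gaussianDensity (δ / 2) (X (k.succAbove j) - u) =
      marginalDensity (δ / 2) X *
        ENNReal.ofReal (weightFactor N δ φ (X k) (particleMean X)) := by
  -- The translation `u = v + φ/(N+1)` makes the exponent the symmetric one plus a term free of `v`.
  rw [← lintegral_add_right_eq_self _ ((1 / ((N : ℝ) + 1)) • φ), marginalDensity,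
    ← lintegral_mul_const]
  swap
  · fun_prop
  refine lintegral_congr fun v => ?_
  simp only [gaussianDensity]
  rw [← ENNReal.ofReal_prod_of_nonneg fun i _ => by positivity,
    ← ENNReal.ofReal_mul (by positivity), ← ENNReal.ofReal_prod_of_nonneg fun i _ => by positivity,
    ← ENNReal.ofReal_mul (by positivity)]
  congr 1
  rw [Finset.prod_mul_distrib, Finset.prod_mul_distrib, ← Real.exp_sum, ← Real.exp_sum,
    weightFactor, mul_mul_mul_comm, ← Real.exp_add, mul_assoc (∏ _i, _), ← Real.exp_add]
  simp only [Finset.prod_const, Finset.card_univ, Fintype.card_fin, ← Finset.sum_div,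
    Finset.sum_neg_distrib]
  rw [pow_succ' _ N]
  congr 2
  have h := quadratic_identity X k φ v
  rw [show (2 : ℝ) * (δ / 2) = δ by ring]
  linear_combination (-1 / δ) * h

/-- The joint density of reference and proposed particles depends on `k` only through the weight of
particle `k`. -/
lemma lintegral_reference_propose (κ : ℝ) {δ : ℝ} (hδ : 0 < δ) (q : Fin (N + 1) → State D → ℝ)
    (k : Fin (N + 1)) (hq : Measurable (q k)) (hq0 : ∀ x, 0 ≤ q k x)
    (hd : Measurable (drift κ δ (q k)))
    {F : State D → (Fin (N + 1) → State D) → ℝ≥0∞} (hF : Measurable (Function.uncurry F)) :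
    ∫⁻ x, ENNReal.ofReal (q k x) * ∫⁻ X, F x X ∂propose κ δ (q k) x k =
      ∫⁻ X, marginalDensity (δ / 2) X * ENNReal.ofReal (weight κ δ q X k) * F (X k) X := by
  have hm : Measurable fun X : Fin (N + 1) → State D =>
      marginalDensity (δ / 2) X * ENNReal.ofReal (weight κ δ q X k) * F (X k) X := by
    refine ((measurable_marginalDensity _).mul (Measurable.ennreal_ofReal ?_)).mul
      (measurable_comp₂ hF (measurable_pi_apply k) measurable_id)
    unfold weight weightFactor particleMean
    have hqX : Measurable fun X : Fin (N + 1) → State D => q k (X k) :=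
      hq.comp (measurable_pi_apply k)
    have hdX : Measurable fun X : Fin (N + 1) → State D => drift κ δ (q k) (X k) :=
      hd.comp (measurable_pi_apply k)
    fun_prop
  rw [volume_pi, lintegral_pi_insertNth _ (fun _ => inferInstance) k hm]
  refine lintegral_congr fun x => ?_
  have hFx : Measurable (F x) := hF.of_uncurry_left
  rw [lintegral_propose κ hδ _ x k hFx, ← lintegral_const_mul']
  swap
  · exact ENNReal.ofReal_ne_top
  refine lintegral_congr fun y => ?_
  have h := lintegral_tilted_gaussian hδ (k.insertNth x y : Fin (N + 1) → State D) k
    (drift κ δ (q k) x)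
  simp only [Fin.insertNth_apply_same, Fin.insertNth_apply_succAbove] at h
  rw [h, weight]
  simp only [Fin.insertNth_apply_same]
  rw [ENNReal.ofReal_mul (hq0 x)]
  ring

end Proposal

/-! ### Index laws: ancestors, forced move, normalised weights -/

section FiniteLaws

variable {N : ℕ}

@[simp]
lemma categorical_singleton (p : Fin (N + 1) → ℝ) (i : Fin (N + 1)) :
    categorical p {i} = ENNReal.ofReal (p i) := by
  simp [categorical, Measure.finsetSum_apply, Set.indicator_apply]

lemma isProbabilityMeasure_categorical {p : Fin (N + 1) → ℝ} (hp : ∀ i, 0 ≤ p i)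
    (hp1 : ∑ i, p i = 1) : IsProbabilityMeasure (categorical p) :=
  ⟨by simp [categorical, ← ENNReal.ofReal_sum_of_nonneg fun i _ => hp i, hp1]⟩

/-- Holds without normalisation, so that product formulas and measurability in `W` are available for
arbitrary real weights. -/
instance (p : Fin (N + 1) → ℝ) : IsFiniteMeasure (categorical p) :=
  ⟨by simp [categorical, ENNReal.sum_lt_top]⟩

instance : IsProbabilityMeasure (uniformIndex N) :=
  isProbabilityMeasure_categorical (fun _ => by positivity) (by simp; field_simp)

lemma isFiniteMeasure_ancestor (W : Fin (N + 1) → ℝ) (k k' n : Fin (N + 1)) :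
    IsFiniteMeasure (if n = k' then Measure.dirac k else categorical W) := by
  split_ifs <;> infer_instance

lemma isProbabilityMeasure_ancestors {W : Fin (N + 1) → ℝ} (hW : ∀ i, 0 ≤ W i)
    (hW1 : ∑ i, W i = 1) (k k' : Fin (N + 1)) : IsProbabilityMeasure (ancestors W k k') := by
  have : ∀ n : Fin (N + 1),
      IsProbabilityMeasure (if n = k' then Measure.dirac k else categorical W) := fun n => by
    have := isProbabilityMeasure_categorical hW hW1
    split_ifs <;> infer_instance
  unfold ancestors
  infer_instance

lemma ancestors_singleton (W : Fin (N + 1) → ℝ) (k k' : Fin (N + 1))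
    (a : Fin (N + 1) → Fin (N + 1)) :
    ancestors W k k' {a} =
      ∏ n, if n = k' then (if a n = k then 1 else 0) else ENNReal.ofReal (W (a n)) := by
  have := isFiniteMeasure_ancestor W k k'
  rw [ancestors, Measure.pi_singleton]
  refine Finset.prod_congr rfl fun n _ => ?_
  split_ifs with h1 h2 <;> simp_all [eq_comm]

lemma measurable_ancestors_singleton {α : Type*} [MeasurableSpace α] {W : α → Fin (N + 1) → ℝ}
    (hW : Measurable W) (k k' : Fin (N + 1)) (a : Fin (N + 1) → Fin (N + 1)) :
    Measurable fun b => ancestors (W b) k k' {a} := by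
  simp_rw [ancestors_singleton]
  refine Finset.measurable_prod _ fun n _ => ?_
  split_ifs <;> fun_prop

/-- Drawing the reference position from `W` and then the ancestors amounts to drawing all
ancestors independently from `W`. -/
lemma sum_mul_ancestors (W : Fin (N + 1) → ℝ)
    (k' : Fin (N + 1)) (H : Fin (N + 1) → (Fin (N + 1) → Fin (N + 1)) → ℝ≥0∞) :
    ∑ k, ENNReal.ofReal (W k) * ∑ a, ancestors W k k' {a} * H k a =
      ∑ a, (∏ n, ENNReal.ofReal (W (a n))) * H (a k') a := by
  simp_rw [Finset.mul_sum]
  rw [Finset.sum_comm]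
  refine Finset.sum_congr rfl fun a _ => ?_
  -- The Dirac mass at position `k'` forces `k = a k'`, and the factor `W k` then replaces the
  -- missing factor `W (a k')`.
  rw [Finset.sum_eq_single (a k')]
  · rw [ancestors_singleton, ← mul_assoc]
    congr 1
    rw [← Finset.mul_prod_erase _ _ (Finset.mem_univ k'),
      ← Finset.mul_prod_erase _ (fun n => ENNReal.ofReal (W (a n))) (Finset.mem_univ k')]
    simp only [if_true, one_mul]
    congr 1
    refine Finset.prod_congr rfl fun n hn => ?_
    rw [if_neg (Finset.ne_of_mem_erase hn)]
  · intro k _ hk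
    rw [ancestors_singleton, Finset.prod_eq_zero (Finset.mem_univ k') (by simp [hk.symm])]
    simp
  · simp

lemma map_of_finite {β : Type*} [MeasurableSpace β] (μ : Measure (Fin (N + 1)))
    (g : Fin (N + 1) → β) : μ.map g = ∑ i, μ {i} • Measure.dirac (g i) := by
  rw [← bind_of_finite μ (fun i => Measure.dirac (g i)),
    Measure.bind_dirac_eq_map μ (measurable_of_finite g)]

lemma sum_measure_singleton (μ : Measure (Fin (N + 1))) [IsProbabilityMeasure μ] :
    ∑ i, μ {i} = 1 := by
  simp

/-- The acceptance probability of the forced move from `k` to `i`. -/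
noncomputable def acceptance (W : Fin (N + 1) → ℝ) (k i : Fin (N + 1)) : ℝ :=
  min 1 ((1 - W k) / (1 - W i))

lemma forcedMove_singleton (W : Fin (N + 1) → ℝ) (k l : Fin (N + 1)) :
    forcedMove W k {l} = ∑ i, ENNReal.ofReal (if i = k then 0 else W i / (1 - W k)) *
      (ENNReal.ofReal (acceptance W k i) * (if i = l then 1 else 0) +
        ENNReal.ofReal (1 - acceptance W k i) * (if k = l then 1 else 0)) := by
  rw [forcedMove, bind_of_finite]
  simp [Measure.finsetSum_apply, Set.indicator_apply, acceptance, mul_add]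

lemma measurable_forcedMove_singleton {α : Type*} [MeasurableSpace α] {W : α → Fin (N + 1) → ℝ}
    (hW : Measurable W) (k l : Fin (N + 1)) : Measurable fun b => forcedMove (W b) k {l} := by
  simp_rw [forcedMove_singleton, acceptance]
  refine Finset.measurable_sum _ fun i _ => ?_
  split_ifs <;> fun_prop

variable {W : Fin (N + 1) → ℝ}

/-- With `N ≥ 1` some other particle carries positive weight. This keeps the denominators `1 - W k`
of the forced move positive. -/
lemma lt_one_of_sum_eq_one (hN : 1 ≤ N) (hW : ∀ i, 0 < W i) (hW1 : ∑ i, W i = 1)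
    (k : Fin (N + 1)) : W k < 1 := by
  have : Nontrivial (Fin (N + 1)) := Fin.nontrivial_iff_two_le.2 (by omega)
  obtain ⟨j, hj⟩ := exists_ne k
  rw [← hW1]
  exact Finset.single_lt_sum hj (Finset.mem_univ _) (Finset.mem_univ _) (hW j)
    fun i _ _ => (hW i).le

lemma isProbabilityMeasure_forcedMove (hN : 1 ≤ N) (hW : ∀ i, 0 < W i) (hW1 : ∑ i, W i = 1)
    (k : Fin (N + 1)) : IsProbabilityMeasure (forcedMove W k) := by
  have hlt := lt_one_of_sum_eq_one hN hW hW1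
  have hk : 0 < 1 - W k := sub_pos.2 (hlt k)
  have : IsProbabilityMeasure (categorical fun i => if i = k then 0 else W i / (1 - W k)) := by
    refine isProbabilityMeasure_categorical (fun i => ?_) ?_
    · have := (hW i).le
      split_ifs <;> positivity
    · rw [← Finset.add_sum_erase _ _ (Finset.mem_univ k)]
      rw [← Finset.add_sum_erase _ _ (Finset.mem_univ k)] at hW1
      rw [Finset.sum_congr rfl fun i hi => if_neg (Finset.ne_of_mem_erase hi), ← Finset.sum_div,
        if_pos rfl, zero_add, div_eq_one_iff_eq hk.ne']
      linarith
  refine isProbabilityMeasure_bind (measurable_of_finite _) fun i => ⟨?_⟩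
  have hi : 0 < 1 - W i := sub_pos.2 (hlt i)
  have h0 : 0 ≤ min 1 ((1 - W k) / (1 - W i)) := by positivity
  simp only [Measure.add_apply, Measure.smul_apply, measure_univ, smul_eq_mul, mul_one]
  rw [← ENNReal.ofReal_add h0 (sub_nonneg.2 (min_le_left _ _))]
  simp

/-- For distinct indices the flow is `W i * W j * min (1 / (1 - W i)) (1 / (1 - W j))`, which is
symmetric; on the diagonal nothing has to be computed. -/
lemma forcedMove_detailed_balance (hN : 1 ≤ N) (hW : ∀ i, 0 < W i) (hW1 : ∑ i, W i = 1)
    (k l : Fin (N + 1)) :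
    ENNReal.ofReal (W k) * forcedMove W k {l} = ENNReal.ofReal (W l) * forcedMove W l {k} := by
  have hlt := lt_one_of_sum_eq_one hN hW hW1
  have key : ∀ i j, i ≠ j → ENNReal.ofReal (W i) * forcedMove W i {j} =
      ENNReal.ofReal (W i * W j * min (1 / (1 - W i)) (1 / (1 - W j))) := by
    intro i j hij
    have hi : 0 < 1 - W i := sub_pos.2 (hlt i)
    have hj : 0 < 1 - W j := sub_pos.2 (hlt j)
    have hj0 := (hW j).le
    rw [forcedMove_singleton, Finset.sum_eq_single j (fun n _ hn => by simp [hn, hij])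
      (by simp)]
    simp only [hij, hij.symm, if_true, if_false, mul_one, mul_zero, add_zero]
    rw [← ENNReal.ofReal_mul (by positivity), ← ENNReal.ofReal_mul (hW i).le]
    congr 1
    rw [acceptance, show min (1 / (1 - W i)) (1 / (1 - W j)) =
      1 / (1 - W i) * min 1 ((1 - W i) / (1 - W j)) by
        rw [mul_min_of_nonneg _ _ (by positivity)]; congr 1 <;> field_simp]
    ring
  rcases eq_or_ne k l with rfl | h
  · rfl
  · rw [key k l h, key l k h.symm, min_comm, mul_comm (W k)]

/-- The forced move leaves the categorical distribution with weights `W` invariant. -/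
lemma sum_mul_forcedMove (hN : 1 ≤ N) (hW : ∀ i, 0 < W i) (hW1 : ∑ i, W i = 1)
    (l : Fin (N + 1)) :
    ∑ k, ENNReal.ofReal (W k) * forcedMove W k {l} = ENNReal.ofReal (W l) := by
  have := isProbabilityMeasure_forcedMove hN hW hW1 l
  simp_rw [fun k => forcedMove_detailed_balance hN hW hW1 k l]
  rw [← Finset.mul_sum, sum_measure_singleton, mul_one]

lemma normalise_pos {w : Fin (N + 1) → ℝ} (hw : ∀ i, 0 < w i) (n : Fin (N + 1)) :
    0 < normalise w n :=
  div_pos (hw n) (Finset.sum_pos (fun i _ => hw i) Finset.univ_nonempty)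

lemma sum_normalise {w : Fin (N + 1) → ℝ} (hw : ∀ i, 0 < w i) : ∑ n, normalise w n = 1 := by
  have : 0 < ∑ n, w n := Finset.sum_pos (fun i _ => hw i) Finset.univ_nonempty
  simp_rw [normalise]
  rw [← Finset.sum_div, div_self this.ne']

lemma ofReal_eq_sum_mul_normalise {w : Fin (N + 1) → ℝ} (hw : ∀ i, 0 < w i) (n : Fin (N + 1)) :
    ENNReal.ofReal (w n) = ENNReal.ofReal (∑ j, w j) * ENNReal.ofReal (normalise w n) := by
  have : 0 < ∑ n, w n := Finset.sum_pos (fun i _ => hw i) Finset.univ_nonempty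
  rw [← ENNReal.ofReal_mul this.le, normalise, mul_div_cancel₀ _ this.ne']

end FiniteLaws

/-! ### Measurability of drifts and weights; the exchange principle -/

section Regularity

variable {D N : ℕ}

/-- Positivity and measurability of a transition density together with measurability of its
gradient drift. -/
structure RegularTransition (q : State D → State D → ℝ) : Prop where
  pos : ∀ x y, 0 < q x y
  measurable : Measurable (Function.uncurry q)
  measurable_drift : ∀ κ δ, Measurable fun p : State D × State D => drift κ δ (q p.1) p.2

/-- The gradient need not be continuous: joint continuity of `log q` already makes its derivative in
the second variable jointly measurable. -/
lemma regularTransition_of_differentiable {q : State D → State D → ℝ} (hpos : ∀ x y, 0 < q x y)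
    (hq : Differentiable ℝ fun p : State D × State D => q p.1 p.2) : RegularTransition q where
  pos := hpos
  measurable := hq.continuous.measurable
  measurable_drift κ δ := by
    have hc : Continuous (Function.uncurry fun x y => Real.log (q x y)) :=
      hq.continuous.log fun p => (hpos p.1 p.2).ne'
    exact ((InnerProductSpace.toDual ℝ (State D)).symm.continuous.measurable.comp
      (measurable_fderiv_with_param ℝ hc)).const_smul (κ * (δ / 2))

lemma drift_const_mul (κ δ : ℝ) {c : ℝ} (hc : 0 < c) {f : State D → ℝ} (hf : ∀ x, 0 < f x)
    (x : State D) : drift κ δ (fun y => c * f y) x = drift κ δ f x := by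
  simp_rw [drift, gradient, fun y => Real.log_mul hc.ne' (hf y).ne', fderiv_const_add]

lemma propose_const_mul (κ δ : ℝ) {c : ℝ} (hc : 0 < c) {f : State D → ℝ} (hf : ∀ x, 0 < f x)
    (x : State D) (k : Fin (N + 1)) :
    propose κ δ (fun y => c * f y) x k = propose κ δ f x k := by
  rw [propose, propose, drift_const_mul κ δ hc hf]

lemma weight_pos (κ δ : ℝ) {q : Fin (N + 1) → State D → ℝ} (hq : ∀ n x, 0 < q n x)
    (X : Fin (N + 1) → State D) (n : Fin (N + 1)) : 0 < weight κ δ q X n :=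
  mul_pos (hq n _) (Real.exp_pos _)

lemma measurable_weight (κ δ : ℝ) {α : Type*} [MeasurableSpace α]
    {q : α → Fin (N + 1) → State D → ℝ} {X : α → Fin (N + 1) → State D} (hX : Measurable X)
    (hq : ∀ n, Measurable fun a => q a n (X a n))
    (hd : ∀ n, Measurable fun a => drift κ δ (q a n) (X a n)) :
    Measurable fun a => weight κ δ (q a) (X a) := by
  refine measurable_pi_lambda _ fun n => ?_
  have h : Measurable fun p : State D × (Fin (N + 1) → State D) =>
      weightFactor N δ p.1 (p.2 n) (particleMean p.2) := by
    unfold weightFactor particleMean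
    fun_prop
  have hw := h.comp ((hd n).prodMk hX)
  exact (hq n).mul hw

lemma measurable_normalise {α : Type*} [MeasurableSpace α] {w : α → Fin (N + 1) → ℝ}
    (hw : Measurable w) : Measurable fun a => normalise (w a) := by
  refine measurable_pi_lambda _ fun n => ?_
  unfold normalise
  fun_prop

/-- If two functionals of the particles have the same average over the normalised weights, then
they have the same integral over a reference point and particles proposed from it. -/
lemma sum_lintegral_propose_congr (κ : ℝ) {δ : ℝ} (hδ : 0 < δ) {q : Fin (N + 1) → State D → ℝ}
    (hpos : ∀ n x, 0 < q n x) (hq : ∀ n, Measurable (q n)) (hd : ∀ n, Measurable (drift κ δ (q n)))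
    {F G : Fin (N + 1) → State D → (Fin (N + 1) → State D) → ℝ≥0∞}
    (hF : ∀ k, Measurable (Function.uncurry (F k))) (hG : ∀ k, Measurable (Function.uncurry (G k)))
    (hFG : ∀ X, ∑ k, ENNReal.ofReal (normalise (weight κ δ q X) k) * F k (X k) X =
      ∑ k, ENNReal.ofReal (normalise (weight κ δ q X) k) * G k (X k) X) :
    ∑ k, ∫⁻ x, ENNReal.ofReal (q k x) * ∫⁻ X, F k x X ∂propose κ δ (q k) x k =
      ∑ k, ∫⁻ x, ENNReal.ofReal (q k x) * ∫⁻ X, G k x X ∂propose κ δ (q k) x k := by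
  have hw : Measurable fun X : Fin (N + 1) → State D => weight κ δ q X :=
    measurable_weight κ δ measurable_id (fun n => (hq n).comp (measurable_pi_apply n))
      (fun n => (hd n).comp (measurable_pi_apply n))
  -- Writing `w^k = (∑ w) W^k` pulls out a factor independent of `k`, so that only the `W`-average
  -- of `H` enters.
  have key : ∀ H : Fin (N + 1) → State D → (Fin (N + 1) → State D) → ℝ≥0∞,
      (∀ k, Measurable (Function.uncurry (H k))) →
      ∑ k, ∫⁻ x, ENNReal.ofReal (q k x) * ∫⁻ X, H k x X ∂propose κ δ (q k) x k =
        ∫⁻ X, marginalDensity (δ / 2) X * ENNReal.ofReal (∑ j, weight κ δ q X j) *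
          ∑ k, ENNReal.ofReal (normalise (weight κ δ q X) k) * H k (X k) X := by
    intro H hH
    simp_rw [fun k => lintegral_reference_propose κ hδ q k (hq k) (fun x => (hpos k x).le) (hd k)
      (hH k)]
    rw [← lintegral_finsetSum]
    · refine lintegral_congr fun X => ?_
      rw [Finset.mul_sum]
      refine Finset.sum_congr rfl fun k _ => ?_
      rw [ofReal_eq_sum_mul_normalise (weight_pos κ δ hpos X) k]
      ring
    · intro k _
      have hwk : Measurable fun X : Fin (N + 1) → State D => weight κ δ q X k := by fun_prop
      exact ((measurable_marginalDensity _).mul hwk.ennreal_ofReal).mul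
        (measurable_comp₂ (hH k) (measurable_pi_apply k) measurable_id)
  rw [key F hF, key G hG]
  simp_rw [hFG]

end Regularity

/-! ### The recursion after the first step: regularity and the backward draw -/

section Remainder

variable {D N : ℕ}

/-- The filter value `γ` enters only as a positive factor inside a log-gradient, which does not see
it. -/
lemma remainder_eq_one (κ : ℝ) {m : ℕ} {Q : Fin m → State D → State D → ℝ}
    (hQ : ∀ i, RegularTransition (Q i)) (δ : Fin m → ℝ) (x : Fin (m + 1) → State D) {γ : ℝ}
    (hγ : 0 < γ) (k : Fin (N + 1)) (X : Fin (N + 1) → State D) (W : Fin (N + 1) → ℝ) :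
    remainder κ m Q δ x γ k X W = remainder κ m Q δ x 1 k X W := by
  induction m generalizing γ k X W with
  | zero => rfl
  | succ m ih =>
    have h0 := (hQ 0).pos (x 0)
    have hQ' : ∀ i : Fin m, RegularTransition (Q i.succ) := fun i => hQ i.succ
    have hc : ∀ c : ℝ, 0 < c → ∀ (k' : Fin (N + 1)) (X' : Fin (N + 1) → State D) W',
        remainder κ m (fun i => Q i.succ) (fun i => δ i.succ) (fun i => x i.succ)
          (c * Q 0 (x 0) (x 1)) k' X' W' =
        remainder κ m (fun i => Q i.succ) (fun i => δ i.succ) (fun i => x i.succ) 1 k' X' W' :=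
      fun c hc k' X' W' => ih hQ' _ _ (mul_pos hc (h0 _)) _ _ _
    simp only [remainder, propose_const_mul κ _ hγ h0, propose_const_mul κ _ one_pos h0,
      hc γ hγ, hc 1 one_pos]

/-- The law of the path obtained from a path `y` by prepending a particle drawn by backward
sampling. -/
noncomputable def backwardStep {m : ℕ} (q : State D → State D → ℝ) (X : Fin (N + 1) → State D)
    (W : Fin (N + 1) → ℝ) (y : Fin (m + 1) → State D) : Measure (Fin (m + 2) → State D) :=
  (backwardIndex W (fun i => q (X i) (y 0))).map
    (fun l => (Fin.cons (X l) y : Fin (m + 2) → State D))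

/-- The normalised weights after the move from particles `X` with ancestors `a` to `X'`. -/
noncomputable def nextWeights (κ δ : ℝ) (q : State D → State D → ℝ) (X : Fin (N + 1) → State D)
    (a : Fin (N + 1) → Fin (N + 1)) (X' : Fin (N + 1) → State D) : Fin (N + 1) → ℝ :=
  normalise (weight κ δ (fun n => q (X (a n))) X')

lemma nextWeights_pos (κ δ : ℝ) {q : State D → State D → ℝ} (hq : RegularTransition q)
    (X : Fin (N + 1) → State D) (a : Fin (N + 1) → Fin (N + 1)) (X' : Fin (N + 1) → State D)
    (n : Fin (N + 1)) : 0 < nextWeights κ δ q X a X' n :=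
  normalise_pos (weight_pos κ δ (fun n => hq.pos (X (a n))) X') n

lemma sum_nextWeights (κ δ : ℝ) {q : State D → State D → ℝ} (hq : RegularTransition q)
    (X : Fin (N + 1) → State D) (a : Fin (N + 1) → Fin (N + 1)) (X' : Fin (N + 1) → State D) :
    ∑ n, nextWeights κ δ q X a X' n = 1 :=
  sum_normalise (weight_pos κ δ (fun n => hq.pos (X (a n))) X')

lemma measurable_drift_comp (κ δ : ℝ) {q : State D → State D → ℝ} (hq : RegularTransition q)
    {α : Type*} [MeasurableSpace α] {x y : α → State D} (hx : Measurable x) (hy : Measurable y) :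
    Measurable fun b => drift κ δ (q (x b)) (y b) :=
  measurable_comp₂ (F := fun x y => drift κ δ (q x) y) (hq.measurable_drift κ δ) hx hy

lemma measurable_nextWeights (κ δ : ℝ) {q : State D → State D → ℝ} (hq : RegularTransition q)
    {α : Type*} [MeasurableSpace α] {X X' : α → Fin (N + 1) → State D}
    (hX : Measurable X) (hX' : Measurable X') (a : Fin (N + 1) → Fin (N + 1)) :
    Measurable fun b => nextWeights κ δ q (X b) a (X' b) := by
  have hXn : ∀ n, Measurable fun b => X b n := fun n => by fun_prop
  have hXn' : ∀ n, Measurable fun b => X' b n := fun n => by fun_prop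
  exact measurable_normalise (measurable_weight κ δ hX'
    (fun n => measurable_comp₂ hq.measurable (hXn (a n)) (hXn' n))
    fun n => measurable_drift_comp κ δ hq (hXn (a n)) (hXn' n))

lemma remainder_succ (κ : ℝ) {m : ℕ} {Q : Fin (m + 1) → State D → State D → ℝ}
    (hQ : ∀ i, RegularTransition (Q i)) (δ : Fin (m + 1) → ℝ) (x : Fin (m + 2) → State D)
    (k : Fin (N + 1)) (X : Fin (N + 1) → State D) (W : Fin (N + 1) → ℝ) :
    remainder κ (m + 1) Q δ x 1 k X W =
      (uniformIndex N).bind fun k' => (ancestors W k k').bind fun a =>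
        (propose κ (δ 0) (Q 0 (x 0)) (x 1) k').bind fun X' =>
          (remainder κ m (fun i => Q i.succ) (fun i => δ i.succ) (fun i => x i.succ) 1 k' X'
            (nextWeights κ (δ 0) (Q 0) X a X')).bind (backwardStep (Q 0) X W) := by
  have h0 := (hQ 0).pos (x 0)
  have hQ' : ∀ i : Fin m, RegularTransition (Q i.succ) := fun i => hQ i.succ
  have hc : ∀ (k' : Fin (N + 1)) (X' : Fin (N + 1) → State D) W',
      remainder κ m (fun i => Q i.succ) (fun i => δ i.succ) (fun i => x i.succ)
        (1 * Q 0 (x 0) (x 1)) k' X' W' =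
      remainder κ m (fun i => Q i.succ) (fun i => δ i.succ) (fun i => x i.succ) 1 k' X' W' :=
    fun k' X' W' => remainder_eq_one κ hQ' _ _ (mul_pos one_pos (h0 _)) _ _ _
  rw [remainder]
  simp only [hc, propose_const_mul κ _ one_pos h0]
  rfl

@[fun_prop]
lemma measurable_cons {α β : Type*} [MeasurableSpace α] [MeasurableSpace β] {n : ℕ} {f : β → α}
    {g : β → Fin n → α} (hf : Measurable f) (hg : Measurable g) :
    Measurable fun b => (Fin.cons (f b) (g b) : Fin (n + 1) → α) := by
  simp_rw [← Fin.insertNth_zero']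
  exact measurable_insertNth 0 hf hg

section Backward

variable {q : State D → State D → ℝ}

lemma backwardIndex_singleton (W r : Fin (N + 1) → ℝ) (l : Fin (N + 1)) :
    backwardIndex W r {l} = ENNReal.ofReal (W l * r l / ∑ n, W n * r n) := by
  simp [backwardIndex]

lemma measurable_backwardStep {m : ℕ} (hq : RegularTransition q) {α : Type*} [MeasurableSpace α]
    {X : α → Fin (N + 1) → State D} {W : α → Fin (N + 1) → ℝ} {y : α → Fin (m + 1) → State D}
    (hX : Measurable X) (hW : Measurable W) (hy : Measurable y) :
    Measurable fun a => backwardStep q (X a) (W a) (y a) := by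
  simp_rw [backwardStep, map_of_finite, backwardIndex_singleton]
  have hqX : ∀ n, Measurable fun a => q (X a n) (y a 0) := fun n =>
    measurable_comp₂ hq.measurable (by fun_prop) (by fun_prop)
  refine measurable_finset_sum_smul _ (fun l _ => ?_) (fun l _ => ?_)
  · have hWl : ∀ n, Measurable fun a => W a n * q (X a n) (y a 0) := fun n =>
      Measurable.mul (by fun_prop) (hqX n)
    exact ((hWl l).div (Finset.measurable_sum _ fun n _ => hWl n)).ennreal_ofReal
  · have hc : Measurable fun a => (Fin.cons (X a l) (y a) : Fin (m + 2) → State D) := by fun_prop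
    exact Measure.measurable_dirac.comp hc

lemma sum_mul_pos (hq : RegularTransition q) {W : Fin (N + 1) → ℝ} (hW : ∀ i, 0 < W i)
    (X : Fin (N + 1) → State D) (y : State D) : 0 < ∑ n, W n * q (X n) y :=
  Finset.sum_pos (fun n _ => mul_pos (hW n) (hq.pos _ _)) Finset.univ_nonempty

lemma isProbabilityMeasure_backwardStep {m : ℕ} (hq : RegularTransition q)
    {W : Fin (N + 1) → ℝ} (hW : ∀ i, 0 < W i) (X : Fin (N + 1) → State D)
    (y : Fin (m + 1) → State D) : IsProbabilityMeasure (backwardStep q X W y) := by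
  have hs := sum_mul_pos hq hW X (y 0)
  have : IsProbabilityMeasure (backwardIndex W fun i => q (X i) (y 0)) := by
    refine isProbabilityMeasure_categorical (fun i => ?_) ?_
    · exact div_nonneg (mul_nonneg (hW i).le (hq.pos _ _).le) hs.le
    · rw [← Finset.sum_div, div_self hs.ne']
  exact Measure.isProbabilityMeasure_map (measurable_of_finite _).aemeasurable

/-- The backward draw is an exact draw from the weights `W k * q (X k) (y 0)`. Their sum appears in
front of the integral and cancels the normalisation. -/
lemma sum_mul_lintegral_backwardStep {m : ℕ} (hq : RegularTransition q)
    {W : Fin (N + 1) → ℝ} (hW : ∀ i, 0 < W i) (X : Fin (N + 1) → State D)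
    (y : Fin (m + 1) → State D) {f : (Fin (m + 2) → State D) → ℝ≥0∞} (hf : Measurable f) :
    ∑ k, ENNReal.ofReal (W k) *
        (ENNReal.ofReal (q (X k) (y 0)) * ∫⁻ z, f z ∂backwardStep q X W y) =
      ∑ k, ENNReal.ofReal (W k) * (ENNReal.ofReal (q (X k) (y 0)) * f (Fin.cons (X k) y)) := by
  have hs := sum_mul_pos hq hW X (y 0)
  have h : ∀ k, ENNReal.ofReal (W k) * ENNReal.ofReal (q (X k) (y 0)) =
      ENNReal.ofReal (W k * q (X k) (y 0)) := fun k => (ENNReal.ofReal_mul (hW k).le).symm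
  simp_rw [← mul_assoc, h]
  rw [← Finset.sum_mul, ← ENNReal.ofReal_sum_of_nonneg
    fun k _ => mul_nonneg (hW k).le (hq.pos _ _).le, backwardStep, map_of_finite,
    lintegral_finsetSum_measure, Finset.mul_sum]
  refine Finset.sum_congr rfl fun k _ => ?_
  rw [lintegral_smul_measure, lintegral_dirac' _ hf, smul_eq_mul, backwardIndex_singleton,
    ← mul_assoc, ← ENNReal.ofReal_mul hs.le, mul_div_cancel₀ _ hs.ne']

end Backward

/-- Measurability of the remainder of the algorithm. -/
def MeasurableRemainder (N : ℕ) (κ : ℝ) {m : ℕ} (Q : Fin m → State D → State D → ℝ)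
    (δ : Fin m → ℝ) : Prop :=
  ∀ k : Fin (N + 1), Measurable
    fun p : (Fin (m + 1) → State D) × (Fin (N + 1) → State D) × (Fin (N + 1) → ℝ) =>
      remainder κ m Q δ p.1 1 k p.2.1 p.2.2

/-- Preservation of mass by the remainder of the algorithm. -/
def MarkovRemainder (N : ℕ) (κ : ℝ) {m : ℕ} (Q : Fin m → State D → State D → ℝ)
    (δ : Fin m → ℝ) : Prop :=
  ∀ (k : Fin (N + 1)) x X (W : Fin (N + 1) → ℝ), (∀ n, 0 < W n) → ∑ n, W n = 1 →
    IsProbabilityMeasure (remainder κ m Q δ x 1 k X W)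

lemma MeasurableRemainder.comp {κ : ℝ} {m : ℕ} {Q : Fin m → State D → State D → ℝ}
    {δ : Fin m → ℝ} (h : MeasurableRemainder N κ Q δ) (k : Fin (N + 1))
    {α : Type*} [MeasurableSpace α] {x : α → Fin (m + 1) → State D}
    {X : α → Fin (N + 1) → State D} {W : α → Fin (N + 1) → ℝ} (hx : Measurable x)
    (hX : Measurable X) (hW : Measurable W) :
    Measurable fun a => remainder κ m Q δ (x a) 1 k (X a) (W a) := by
  have h' := (h k).comp (hx.prodMk (hX.prodMk hW))
  exact h'

lemma remainder_zero_regular (hN : 1 ≤ N) (κ : ℝ) (Q : Fin 0 → State D → State D → ℝ)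
    (δ : Fin 0 → ℝ) : MeasurableRemainder N κ Q δ ∧ MarkovRemainder N κ Q δ := by
  constructor
  · intro k
    simp_rw [remainder, map_of_finite]
    refine measurable_finset_sum_smul _ (fun l _ => ?_) (fun l _ => ?_)
    · exact measurable_forcedMove_singleton (by fun_prop) k l
    · have hc : Measurable fun p : (Fin (0 + 1) → State D) × (Fin (N + 1) → State D) ×
          (Fin (N + 1) → ℝ) => (fun _ => p.2.1 l : Fin (0 + 1) → State D) := by fun_prop
      exact Measure.measurable_dirac.comp hc
  · intro k x X W hW hW1
    have := isProbabilityMeasure_forcedMove hN hW hW1 k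
    rw [remainder]
    exact Measure.isProbabilityMeasure_map (measurable_of_finite _).aemeasurable

lemma measurable_remainder_bind_backwardStep {κ : ℝ} {m : ℕ} {Q : Fin m → State D → State D → ℝ}
    {δ : Fin m → ℝ} (hm : MeasurableRemainder N κ Q δ) (hp : MarkovRemainder N κ Q δ)
    {q : State D → State D → ℝ} (hq : RegularTransition q) (δ₀ : ℝ) (k : Fin (N + 1))
    (a : Fin (N + 1) → Fin (N + 1)) {α : Type*} [MeasurableSpace α]
    {x : α → Fin (m + 1) → State D} {X X' : α → Fin (N + 1) → State D}
    {W : α → Fin (N + 1) → ℝ} (hx : Measurable x)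
    (hX : Measurable X) (hX' : Measurable X') (hW : Measurable W) :
    Measurable fun b => (remainder κ m Q δ (x b) 1 k (X' b)
      (nextWeights κ δ₀ q (X b) a (X' b))).bind (backwardStep q (X b) (W b)) :=
  measurable_bind_of_isProbabilityMeasure (f := fun b y => backwardStep q (X b) (W b) y)
    (hm.comp k hx hX' (measurable_nextWeights κ δ₀ hq hX hX' a))
    (fun _ => hp _ _ _ _ (nextWeights_pos κ δ₀ hq _ _ _) (sum_nextWeights κ δ₀ hq _ _ _))
    (measurable_backwardStep hq (by fun_prop) (by fun_prop) (by fun_prop))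

lemma measurableRemainder_succ {κ : ℝ} {m : ℕ} {Q : Fin (m + 1) → State D → State D → ℝ}
    (hQ : ∀ i, RegularTransition (Q i)) {δ : Fin (m + 1) → ℝ} (hδ : ∀ i, 0 < δ i)
    (hm : MeasurableRemainder N κ (fun i => Q i.succ) fun i => δ i.succ)
    (hp : MarkovRemainder N κ (fun i => Q i.succ) fun i => δ i.succ) :
    MeasurableRemainder N κ Q δ := by
  intro k
  simp_rw [remainder_succ κ hQ, bind_of_finite]
  refine measurable_finset_sum_smul _ (fun _ _ => measurable_const) fun k' _ => ?_
  refine measurable_finset_sum_smul _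
    (fun a _ => measurable_ancestors_singleton (by fun_prop) _ _ _) fun a _ => ?_
  refine measurable_bind_of_isProbabilityMeasure ?_
    (fun p => isProbabilityMeasure_propose κ (hδ 0) _ _ _) ?_
  · exact measurable_propose κ (hδ 0) (by fun_prop)
      (measurable_drift_comp κ (δ 0) (hQ 0) (by fun_prop) (by fun_prop)) k'
  · exact measurable_remainder_bind_backwardStep hm hp (hQ 0) (δ 0) k' a (by fun_prop)
      (by fun_prop) (by fun_prop) (by fun_prop)

lemma markovRemainder_succ {κ : ℝ} {m : ℕ} {Q : Fin (m + 1) → State D → State D → ℝ}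
    (hQ : ∀ i, RegularTransition (Q i)) {δ : Fin (m + 1) → ℝ} (hδ : ∀ i, 0 < δ i)
    (hm : MeasurableRemainder N κ (fun i => Q i.succ) fun i => δ i.succ)
    (hp : MarkovRemainder N κ (fun i => Q i.succ) fun i => δ i.succ) :
    MarkovRemainder N κ Q δ := by
  intro k x X W hW hW1
  rw [remainder_succ κ hQ]
  refine isProbabilityMeasure_bind (measurable_of_finite _) fun k' => ?_
  have := isProbabilityMeasure_ancestors (fun i => (hW i).le) hW1 k k'
  refine isProbabilityMeasure_bind (measurable_of_finite _) fun a => ?_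
  have := isProbabilityMeasure_propose κ (hδ 0) (Q 0 (x 0)) (x 1) k'
  refine isProbabilityMeasure_bind (measurable_remainder_bind_backwardStep hm hp (hQ 0) (δ 0) k' a
    measurable_const measurable_const measurable_id measurable_const) fun X' => ?_
  have := hp k' (fun i => x i.succ) X' _ (nextWeights_pos κ (δ 0) (hQ 0) X a X')
    (sum_nextWeights κ (δ 0) (hQ 0) X a X')
  exact isProbabilityMeasure_bind
    (measurable_backwardStep (hQ 0) measurable_const measurable_const measurable_id)
    fun y => isProbabilityMeasure_backwardStep (hQ 0) hW X y

lemma remainder_regular (hN : 1 ≤ N) (κ : ℝ) {m : ℕ} {Q : Fin m → State D → State D → ℝ}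
    (hQ : ∀ i, RegularTransition (Q i)) {δ : Fin m → ℝ} (hδ : ∀ i, 0 < δ i) :
    MeasurableRemainder N κ Q δ ∧ MarkovRemainder N κ Q δ := by
  induction m with
  | zero => exact remainder_zero_regular hN κ Q δ
  | succ m ih =>
    obtain ⟨hm, hp⟩ := ih (fun i => hQ i.succ) (fun i => hδ i.succ)
    exact ⟨measurableRemainder_succ hQ hδ hm hp, markovRemainder_succ hQ hδ hm hp⟩

end Remainder

/-! ### Invariance of the remainder, by induction on time -/

section Invariance

lemma measurable_lintegral_of_isProbabilityMeasure {α β : Type*} [MeasurableSpace α]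
    [MeasurableSpace β] {μ : α → Measure β} (hμ : Measurable μ)
    (hμp : ∀ a, IsProbabilityMeasure (μ a)) {F : α → β → ℝ≥0∞}
    (hF : Measurable (Function.uncurry F)) : Measurable fun a => ∫⁻ b, F a b ∂μ a := by
  let κ : Kernel α β := ⟨μ, hμ⟩
  have : IsMarkovKernel κ := ⟨hμp⟩
  exact Measurable.lintegral_kernel_prod_right (κ := κ) hF

variable {D N : ℕ}

/-- The product of the transition densities along a path. -/
noncomputable def pathWeight {m : ℕ} (Q : Fin m → State D → State D → ℝ)
    (x : Fin (m + 1) → State D) : ℝ≥0∞ :=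
  ∏ i : Fin m, ENNReal.ofReal (Q i (x i.castSucc) (x i.succ))

lemma measurable_pathWeight {m : ℕ} {Q : Fin m → State D → State D → ℝ}
    (hQ : ∀ i, RegularTransition (Q i)) : Measurable (pathWeight Q) :=
  Finset.measurable_prod _ fun i _ => (measurable_comp₂ (hQ i).measurable
    (by fun_prop) (by fun_prop)).ennreal_ofReal

lemma pathWeight_cons {m : ℕ} (Q : Fin (m + 1) → State D → State D → ℝ) (x : State D)
    (z : Fin (m + 1) → State D) :
    pathWeight Q (Fin.cons x z) =
      ENNReal.ofReal (Q 0 x (z 0)) * pathWeight (fun i => Q i.succ) z := by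
  simp [pathWeight, Fin.prod_univ_succ]

/-- Since the proposal depends on the path only through its first point, the later points can be
integrated before the particles. This brings the integral into the form required by
`sum_lintegral_propose_congr`. -/
lemma lintegral_path_propose {m : ℕ} {K : State D → Measure (Fin (N + 1) → State D)}
    (hK : Measurable K) (hKp : ∀ x, IsProbabilityMeasure (K x)) {q : State D → ℝ≥0∞}
    (hq : Measurable q) {p : (Fin (m + 1) → State D) → ℝ≥0∞} (hp : Measurable p)
    {L : (Fin (m + 1) → State D) → (Fin (N + 1) → State D) → ℝ≥0∞}
    (hL : Measurable (Function.uncurry L)) :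
    ∫⁻ z, q (z 0) * (p z * ∫⁻ X, L z X ∂K (z 0)) =
      ∫⁻ x, q x * ∫⁻ X, (∫⁻ z : Fin m → State D, p (Fin.cons x z) * L (Fin.cons x z) X) ∂K x := by
  have hI : Measurable fun z : Fin (m + 1) → State D => ∫⁻ X, L z X ∂K (z 0) :=
    measurable_lintegral_of_isProbabilityMeasure (hK.comp (measurable_pi_apply 0))
      (fun z => hKp _) hL
  have hm : Measurable fun z : Fin (m + 1) → State D => p z * ∫⁻ X, L z X ∂K (z 0) := hp.mul hI
  have hq0 : Measurable fun z : Fin (m + 1) → State D => q (z 0) := by fun_prop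
  have hqm : Measurable fun z : Fin (m + 1) → State D =>
      q (z 0) * (p z * ∫⁻ X, L z X ∂K (z 0)) := hq0.mul hm
  rw [volume_pi, lintegral_pi_cons _ hqm]
  refine lintegral_congr fun x => ?_
  have hc : Measurable fun z : Fin m → State D => (Fin.cons x z : Fin (m + 1) → State D) := by
    fun_prop
  have hLc : Measurable fun r : (Fin m → State D) × (Fin (N + 1) → State D) =>
      L (Fin.cons x r.1) r.2 := measurable_comp₂ hL (by fun_prop) (by fun_prop)
  have hpc : Measurable fun r : (Fin m → State D) × (Fin (N + 1) → State D) =>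
      p (Fin.cons x r.1) := by fun_prop
  have hmc := hm.comp hc
  simp only [Function.comp_def, Fin.cons_zero] at hmc ⊢
  rw [lintegral_const_mul _ hmc]
  congr 1
  have := hKp x
  rw [← lintegral_lintegral_swap (hpc.mul hLc).aemeasurable]
  refine lintegral_congr fun z => ?_
  rw [lintegral_const_mul]
  exact measurable_comp₂ hL measurable_const measurable_id

lemma lintegral_sum_mul_sum_mul {α ι ι' : Type*} [MeasurableSpace α] [Fintype ι] [Fintype ι']
    {μ : Measure α} (u : ι → ℝ≥0∞) (v : ι → ι' → ℝ≥0∞) {I : ι → ι' → α → ℝ≥0∞}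
    (hI : ∀ i j, Measurable (I i j)) :
    ∫⁻ z, ∑ i, u i * ∑ j, v i j * I i j z ∂μ = ∑ i, u i * ∑ j, v i j * ∫⁻ z, I i j z ∂μ := by
  rw [lintegral_finsetSum _ fun i _ => by fun_prop]
  refine Finset.sum_congr rfl fun i _ => ?_
  rw [lintegral_const_mul _ (by fun_prop), lintegral_finsetSum _ fun j _ => by fun_prop]
  congr 1
  exact Finset.sum_congr rfl fun j _ => lintegral_const_mul _ (hI i j)

/-- The index part of the move from one time to the next. -/
lemma sum_move_congr {W : Fin (N + 1) → ℝ}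
    {H₁ H₂ : Fin (N + 1) → Fin (N + 1) → (Fin (N + 1) → Fin (N + 1)) → ℝ≥0∞}
    (h : ∀ a, ∑ k', H₁ (a k') k' a = ∑ k', H₂ (a k') k' a) :
    ∑ k, ENNReal.ofReal (W k) *
        ∑ k', uniformIndex N {k'} * ∑ a, ancestors W k k' {a} * H₁ k k' a =
      ∑ k, ENNReal.ofReal (W k) *
        ∑ k', uniformIndex N {k'} * ∑ a, ancestors W k k' {a} * H₂ k k' a := by
  -- After summing over `k` first, `H` is evaluated only at `k = a k'`, with a prefactor that does
  -- not involve `k'`.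
  have key : ∀ H : Fin (N + 1) → Fin (N + 1) → (Fin (N + 1) → Fin (N + 1)) → ℝ≥0∞,
      ∑ k, ENNReal.ofReal (W k) *
        ∑ k', uniformIndex N {k'} * ∑ a, ancestors W k k' {a} * H k k' a =
      ENNReal.ofReal (1 / ((N : ℝ) + 1)) *
        ∑ a, (∏ n, ENNReal.ofReal (W (a n))) * ∑ k', H (a k') k' a := by
    intro H
    calc _ = ∑ k', uniformIndex N {k'} *
          ∑ k, ENNReal.ofReal (W k) * ∑ a, ancestors W k k' {a} * H k k' a := by
          simp only [Finset.mul_sum]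
          rw [Finset.sum_comm]
          simp only [mul_left_comm]
      _ = ∑ k', uniformIndex N {k'} *
          ∑ a, (∏ n, ENNReal.ofReal (W (a n))) * H (a k') k' a :=
          Finset.sum_congr rfl fun k' _ => by
            rw [sum_mul_ancestors W k' fun k a => H k k' a]
      _ = _ := by
          simp only [uniformIndex, categorical_singleton, ← Finset.mul_sum]
          rw [Finset.sum_comm]
          simp only [Finset.mul_sum]
  rw [key, key]
  simp_rw [h]

/-- The reference path starts at the particle `X k`, so the proposal at the next time is driven by
`Q 0 (X k)`, the density that also weights the particle whose ancestor is `k`. -/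
lemma lintegral_remainder_succ {κ : ℝ} {m : ℕ} {Q : Fin (m + 1) → State D → State D → ℝ}
    (hQ : ∀ i, RegularTransition (Q i)) {δ : Fin (m + 1) → ℝ}
    (hm : MeasurableRemainder N κ (fun i => Q i.succ) fun i => δ i.succ)
    (hp : MarkovRemainder N κ (fun i => Q i.succ) fun i => δ i.succ)
    (z : Fin (m + 1) → State D) (k : Fin (N + 1)) (X : Fin (N + 1) → State D)
    (W : Fin (N + 1) → ℝ) {f : (Fin (m + 2) → State D) → ℝ≥0∞} (hf : Measurable f) :
    ∫⁻ y, f y ∂remainder κ (m + 1) Q δ (Fin.cons (X k) z) 1 k X W =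
      ∑ k', uniformIndex N {k'} * ∑ a, ancestors W k k' {a} *
        ∫⁻ X', ∫⁻ y, ∫⁻ y', f y' ∂backwardStep (Q 0) X W y
          ∂remainder κ m (fun i => Q i.succ) (fun i => δ i.succ) z 1 k' X'
            (nextWeights κ (δ 0) (Q 0) X a X') ∂propose κ (δ 0) (Q 0 (X k)) (z 0) k' := by
  have hb : Measurable (backwardStep (m := m) (Q 0) X W) :=
    measurable_backwardStep (hQ 0) measurable_const measurable_const measurable_id
  have h1 : (1 : Fin (m + 2)) = Fin.succ 0 := rfl
  rw [remainder_succ κ hQ]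
  simp only [h1, Fin.cons_zero, Fin.cons_succ]
  rw [lintegral_bind_of_finite _ hf]
  refine Finset.sum_congr rfl fun k' _ => ?_
  rw [lintegral_bind_of_finite _ hf]
  congr 1
  refine Finset.sum_congr rfl fun a _ => ?_
  have hX : Measurable fun X' => (remainder κ m (fun i => Q i.succ) (fun i => δ i.succ) z 1 k' X'
      (nextWeights κ (δ 0) (Q 0) X a X')).bind (backwardStep (Q 0) X W) :=
    measurable_remainder_bind_backwardStep hm hp (hQ 0) (δ 0) k' a
      measurable_const measurable_const measurable_id measurable_const
  rw [Measure.lintegral_bind hX.aemeasurable hf.aemeasurable]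
  congr 1
  refine lintegral_congr fun X' => ?_
  rw [Measure.lintegral_bind hb.aemeasurable hf.aemeasurable]

/-- Averaged over a reference position drawn from the weights, the remainder of the algorithm
preserves the path measure started from the particle at the reference position. -/
theorem remainder_invariant (hN : 1 ≤ N) (κ : ℝ) {m : ℕ} {Q : Fin m → State D → State D → ℝ}
    (hQ : ∀ i, RegularTransition (Q i)) {δ : Fin m → ℝ} (hδ : ∀ i, 0 < δ i)
    (X : Fin (N + 1) → State D) {W : Fin (N + 1) → ℝ} (hW : ∀ n, 0 < W n) (hW1 : ∑ n, W n = 1)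
    {f : (Fin (m + 1) → State D) → ℝ≥0∞} (hf : Measurable f) :
    ∑ k, ENNReal.ofReal (W k) * ∫⁻ z : Fin m → State D, pathWeight Q (Fin.cons (X k) z) *
        ∫⁻ y, f y ∂remainder κ m Q δ (Fin.cons (X k) z) 1 k X W =
      ∑ k, ENNReal.ofReal (W k) * ∫⁻ z : Fin m → State D, pathWeight Q (Fin.cons (X k) z) *
        f (Fin.cons (X k) z) := by
  induction m generalizing X W with
  | zero =>
    have hc : ∀ (x : State D) (z : Fin 0 → State D), (Fin.cons x z : Fin (0 + 1) → State D) =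
        fun _ => x := fun x z => by
      ext i; fin_cases i; rfl
    have hv : (volume : Measure (Fin 0 → State D)) Set.univ = 1 := by simp [volume_pi]
    have hr : ∀ k x, ∫⁻ y, f y ∂remainder κ 0 Q δ x 1 k X W =
          ∑ l, forcedMove W k {l} * f (fun _ => X l) := fun k x => by
      rw [remainder, map_of_finite, lintegral_finsetSum_measure]
      simp only [lintegral_smul_measure, lintegral_dirac' _ hf, smul_eq_mul]
    have hw : ∀ x, pathWeight Q x = 1 := fun x => by simp [pathWeight]
    simp only [hr, hc, hw, one_mul, lintegral_const, hv, mul_one, Finset.mul_sum]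
    rw [Finset.sum_comm]
    simp only [← mul_assoc, ← Finset.sum_mul, sum_mul_forcedMove hN hW hW1]
  | succ m ih =>
    have hQ' : ∀ i : Fin m, RegularTransition (Q i.succ) := fun i => hQ i.succ
    obtain ⟨hm, hp⟩ := remainder_regular hN κ hQ' fun i => hδ i.succ
    have hb : Measurable (backwardStep (m := m) (Q 0) X W) :=
      measurable_backwardStep (hQ 0) measurable_const measurable_const measurable_id
    have hpw := measurable_pathWeight hQ'
    set p := pathWeight fun i => Q i.succ with hp_def
    -- The backward draw depends on the later path only, given `X` and `W`. Averaging `f` over it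
    -- yields the test function for the induction hypothesis.
    set g : (Fin (m + 1) → State D) → ℝ≥0∞ :=
      fun y => ∫⁻ y', f y' ∂backwardStep (Q 0) X W y with hg_def
    have hg : Measurable g := (Measure.measurable_lintegral hf).comp hb
    let q : Fin (N + 1) → State D → ℝ := fun k => Q 0 (X k)
    have hqpos : ∀ k x, 0 < q k x := fun k => (hQ 0).pos _
    have hq : ∀ k, Measurable (q k) := fun k => (hQ 0).measurable.of_uncurry_left
    have hd : ∀ k, Measurable (drift κ (δ 0) (q k)) := fun k =>
      measurable_drift_comp κ (δ 0) (hQ 0) measurable_const measurable_id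
    let K : Fin (N + 1) → Fin (N + 1) → State D → Measure (Fin (N + 1) → State D) :=
      fun k k' x => propose κ (δ 0) (q k) x k'
    have hK : ∀ k k', Measurable (K k k') := fun k k' =>
      measurable_propose (γ := fun _ => q k) κ (hδ 0) measurable_id (hd k) k'
    have hKp : ∀ k k' x, IsProbabilityMeasure (K k k' x) := fun k k' x =>
      isProbabilityMeasure_propose κ (hδ 0) (q k) x k'
    let L : (Fin (N + 1) → Fin (N + 1)) → Fin (N + 1) → (Fin (m + 1) → State D) →
        (Fin (N + 1) → State D) → ℝ≥0∞ := fun a k' z X' =>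
      ∫⁻ y, g y ∂remainder κ m (fun i => Q i.succ) (fun i => δ i.succ) z 1 k' X'
        (nextWeights κ (δ 0) (Q 0) X a X')
    have hL : ∀ a k', Measurable (Function.uncurry (L a k')) := fun a k' =>
      (Measure.measurable_lintegral hg).comp (hm.comp k' measurable_fst measurable_snd
        (measurable_nextWeights κ (δ 0) (hQ 0) measurable_const measurable_snd a))
    have hg2 : Measurable (Function.uncurry fun (z : Fin (m + 1) → State D)
        (_ : Fin (N + 1) → State D) => g z) := hg.comp measurable_fst
    have hqE : ∀ k, Measurable fun x => ENNReal.ofReal (q k x) := fun k => (hq k).ennreal_ofReal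
    -- expand one step of the algorithm
    have expand : ∀ k, ∫⁻ z : Fin (m + 1) → State D, pathWeight Q (Fin.cons (X k) z) *
        ∫⁻ y, f y ∂remainder κ (m + 1) Q δ (Fin.cons (X k) z) 1 k X W =
        ∑ k', uniformIndex N {k'} * ∑ a, ancestors W k k' {a} *
          ∫⁻ x, ENNReal.ofReal (q k x) *
            ∫⁻ X', (∫⁻ z : Fin m → State D, p (Fin.cons x z) * L a k' (Fin.cons x z) X') ∂K k k' x := by
      intro k
      have hI : ∀ a k', Measurable fun z : Fin (m + 1) → State D =>
          ENNReal.ofReal (q k (z 0)) * (p z * ∫⁻ X', L a k' z X' ∂K k k' (z 0)) := fun a k' =>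
        ((hqE k).comp (measurable_pi_apply 0)).mul (hpw.mul
          (measurable_lintegral_of_isProbabilityMeasure ((hK k k').comp (measurable_pi_apply 0))
            (fun z => hKp _ _ _) (hL a k')))
      calc _ = ∫⁻ z : Fin (m + 1) → State D, ∑ k', uniformIndex N {k'} *
            ∑ a, ancestors W k k' {a} *
              (ENNReal.ofReal (q k (z 0)) * (p z * ∫⁻ X', L a k' z X' ∂K k k' (z 0))) := by
            refine lintegral_congr fun z => ?_
            rw [lintegral_remainder_succ hQ hm hp z k X W hf, pathWeight_cons]
            simp only [Finset.mul_sum]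
            refine Finset.sum_congr rfl fun k' _ => Finset.sum_congr rfl fun a _ => ?_
            simp only [L, K, q, hg_def, hp_def]
            ring
        _ = _ := by
            rw [lintegral_sum_mul_sum_mul _ _ fun k' a => hI a k']
            refine Finset.sum_congr rfl fun k' _ => ?_
            congr 1
            refine Finset.sum_congr rfl fun a _ => ?_
            rw [lintegral_path_propose (hK k k') (hKp k k') (hqE k) hpw (hL a k')]
    -- Once the output is replaced by the reference path, the integrand ignores the indices and
    -- particles of the next time, and these integrate to one.
    have collapse : ∀ k, ∑ k', uniformIndex N {k'} * ∑ a, ancestors W k k' {a} *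
          ∫⁻ x, ENNReal.ofReal (q k x) *
            ∫⁻ _X', (∫⁻ z : Fin m → State D, p (Fin.cons x z) * g (Fin.cons x z)) ∂K k k' x =
        ∫⁻ z : Fin (m + 1) → State D, ENNReal.ofReal (q k (z 0)) * (p z * g z) := by
      intro k
      have hA : ∀ k', ∑ a, ancestors W k k' {a} = 1 := fun k' => by
        have := isProbabilityMeasure_ancestors (fun i => (hW i).le) hW1 k k'
        simp
      have hE : ∀ k', ∫⁻ x, ENNReal.ofReal (q k x) * ∫⁻ _X',
          (∫⁻ z : Fin m → State D, p (Fin.cons x z) * g (Fin.cons x z)) ∂K k k' x =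
          ∫⁻ z : Fin (m + 1) → State D, ENNReal.ofReal (q k (z 0)) * (p z * g z) := fun k' => by
        rw [← lintegral_path_propose (hK k k') (hKp k k') (hqE k) hpw hg2]
        simp only [lintegral_const, measure_univ, mul_one]
      simp only [hE, ← Finset.sum_mul, hA, one_mul, sum_measure_singleton]
    simp_rw [expand]
    -- Exchange the path returned by the later recursion for the reference path itself; the side
    -- goal, for fixed ancestors, is the one-step symmetry combined with the induction hypothesis.
    rw [sum_move_congr (H₂ := fun k k' _ => ∫⁻ x, ENNReal.ofReal (q k x) *
      ∫⁻ _X', (∫⁻ z : Fin m → State D, p (Fin.cons x z) * g (Fin.cons x z)) ∂K k k' x)]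
    · simp_rw [collapse]
      simp only [← lintegral_const_mul' _ _ ENNReal.ofReal_ne_top]
      have hcons : ∀ k, Measurable fun z : Fin (m + 1) → State D =>
          (Fin.cons (X k) z : Fin (m + 2) → State D) := fun k => by fun_prop
      have hq0 : ∀ k, Measurable fun z : Fin (m + 1) → State D => ENNReal.ofReal (q k (z 0)) :=
        fun k => (hqE k).comp (measurable_pi_apply 0)
      have hl : ∀ k, Measurable fun z : Fin (m + 1) → State D =>
          ENNReal.ofReal (W k) * (ENNReal.ofReal (q k (z 0)) * (p z * g z)) :=
        fun k => ((hq0 k).mul (hpw.mul hg)).const_mul _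
      have hr : ∀ k, Measurable fun z : Fin (m + 1) → State D =>
          ENNReal.ofReal (W k) * (pathWeight Q (Fin.cons (X k) z) * f (Fin.cons (X k) z)) :=
        fun k => (((measurable_pathWeight hQ).comp (hcons k)).mul (hf.comp (hcons k))).const_mul _
      rw [← lintegral_finsetSum _ fun k _ => hl k, ← lintegral_finsetSum _ fun k _ => hr k]
      refine lintegral_congr fun z => ?_
      -- What is left holds pointwise in the continuation `z`: the backward draw resamples the
      -- reference position from its conditional law.
      have h := congrArg (p z * ·) (sum_mul_lintegral_backwardStep (hQ 0) hW X z hf)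
      simp only [Finset.mul_sum] at h
      simp only [pathWeight_cons]
      convert h using 2 <;> (simp only [q, hp_def, hg_def]; ring)
    · intro a
      refine sum_lintegral_propose_congr (q := fun n => q (a n)) κ (hδ 0)
        (fun n => hqpos (a n)) (fun n => hq _) (fun n => hd _)
        (F := fun k' x X' => ∫⁻ z : Fin m → State D, p (Fin.cons x z) * L a k' (Fin.cons x z) X')
        (G := fun k' x _ => ∫⁻ z : Fin m → State D, p (Fin.cons x z) * g (Fin.cons x z)) ?_ ?_ ?_
      · intro k'
        have h : Measurable fun r : (State D × (Fin (N + 1) → State D)) × (Fin m → State D) =>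
            p (Fin.cons r.1.1 r.2) * L a k' (Fin.cons r.1.1 r.2) r.1.2 :=
          Measurable.mul (by fun_prop) (measurable_comp₂ (hL a k') (by fun_prop) (by fun_prop))
        exact h.lintegral_prod_right'
      · intro k'
        have h : Measurable fun r : (State D × (Fin (N + 1) → State D)) × (Fin m → State D) =>
            p (Fin.cons r.1.1 r.2) * g (Fin.cons r.1.1 r.2) := by fun_prop
        exact h.lintegral_prod_right'
      · intro X'
        exact ih hQ' (fun i => hδ i.succ) X' (nextWeights_pos κ (δ 0) (hQ 0) X a X')
          (sum_nextWeights κ (δ 0) (hQ 0) X a X') hg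

end Invariance

/-! ### The first time step, the Markov property and invariance -/

section Validity

variable {D N m : ℕ}

lemma particleMALA_eq (κ : ℝ) {δ : Fin (m + 1) → ℝ} {Q₁ : State D → ℝ} (hQ₁ : ∀ x, 0 < Q₁ x)
    {Q : Fin m → State D → State D → ℝ} (hQ : ∀ i, RegularTransition (Q i))
    (x : Fin (m + 1) → State D) :
    particleMALA N κ δ Q₁ Q x = ∑ k, uniformIndex N {k} • (propose κ (δ 0) Q₁ (x 0) k).bind
      fun X => remainder κ m Q (fun i => δ i.succ) x 1 k X
        (normalise (weight κ (δ 0) (fun _ => Q₁) X)) := by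
  rw [particleMALA, bind_of_finite]
  simp only [remainder_eq_one κ hQ _ x (hQ₁ (x 0))]

variable {κ : ℝ} {δ : Fin (m + 1) → ℝ} {Q₁ : State D → ℝ} {Q : Fin m → State D → State D → ℝ}

lemma measurable_initial_remainder (hN : 1 ≤ N) (hδ : ∀ t, 0 < δ t)
    (hQ₁ : RegularTransition fun _ : State D => Q₁) (hQ : ∀ i, RegularTransition (Q i))
    (k : Fin (N + 1)) :
    Measurable fun p : (Fin (m + 1) → State D) × (Fin (N + 1) → State D) =>
      remainder κ m Q (fun i => δ i.succ) p.1 1 k p.2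
        (normalise (weight κ (δ 0) (fun _ => Q₁) p.2)) := by
  -- `Q₁` is treated as a transition that ignores its first argument, so the previous particles and
  -- the ancestors, here `p.2` and `id`, are arbitrary.
  have hw := measurable_nextWeights (N := N) κ (δ 0) hQ₁
    (X := fun p : (Fin (m + 1) → State D) × (Fin (N + 1) → State D) => p.2)
    measurable_snd measurable_snd id
  exact (remainder_regular hN κ hQ fun i => hδ i.succ).1.comp k measurable_fst measurable_snd hw

lemma measurable_initial_propose (hδ : ∀ t, 0 < δ t)
    (hQ₁ : RegularTransition fun _ : State D => Q₁) (k : Fin (N + 1)) :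
    Measurable fun x => propose κ (δ 0) Q₁ x k :=
  measurable_propose (γ := fun _ => Q₁) κ (hδ 0) measurable_id
    (measurable_drift_comp κ (δ 0) hQ₁ measurable_id measurable_id) k

lemma measurable_particleMALA (hN : 1 ≤ N) (hδ : ∀ t, 0 < δ t)
    (hQ₁ : RegularTransition fun _ : State D => Q₁) (hQ : ∀ i, RegularTransition (Q i)) :
    Measurable (particleMALA N κ δ Q₁ Q) := by
  have h : particleMALA N κ δ Q₁ Q = _ := funext (particleMALA_eq κ (hQ₁.pos 0) hQ)
  rw [h]
  refine measurable_finset_sum_smul _ (fun _ _ => measurable_const) fun k _ => ?_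
  exact measurable_bind_of_isProbabilityMeasure
    ((measurable_initial_propose hδ hQ₁ k).comp (measurable_pi_apply 0))
    (fun x => isProbabilityMeasure_propose κ (hδ 0) _ _ _)
    (measurable_initial_remainder hN hδ hQ₁ hQ k)

lemma isProbabilityMeasure_particleMALA (hN : 1 ≤ N) (hδ : ∀ t, 0 < δ t)
    (hQ₁ : RegularTransition fun _ : State D => Q₁) (hQ : ∀ i, RegularTransition (Q i))
    (x : Fin (m + 1) → State D) : IsProbabilityMeasure (particleMALA N κ δ Q₁ Q x) := by
  rw [particleMALA_eq κ (hQ₁.pos 0) hQ, ← bind_of_finite]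
  refine isProbabilityMeasure_bind (measurable_of_finite _) fun k => ?_
  have := isProbabilityMeasure_propose κ (hδ 0) Q₁ (x 0) k
  have hm := (measurable_initial_remainder (κ := κ) hN hδ hQ₁ hQ k).comp
    (measurable_prodMk_left (x := x))
  refine isProbabilityMeasure_bind hm fun X => ?_
  have hw := weight_pos κ (δ 0) (fun _ => hQ₁.pos 0) X
  exact (remainder_regular hN κ hQ fun i => hδ i.succ).2 k x X _ (normalise_pos hw)
    (sum_normalise hw)

lemma ofReal_pathDensity (hQ₁ : ∀ x, 0 < Q₁ x) (hQ : ∀ i, RegularTransition (Q i))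
    (x : Fin (m + 1) → State D) :
    ENNReal.ofReal (pathDensity Q₁ Q x) = ENNReal.ofReal (Q₁ (x 0)) * pathWeight Q x := by
  rw [pathDensity, ENNReal.ofReal_mul (hQ₁ _).le,
    ENNReal.ofReal_prod_of_nonneg fun i _ => ((hQ i).pos _ _).le, pathWeight]

/-- Invariance of the unnormalised path measure, tested against a function. -/
lemma lintegral_particleMALA (hN : 1 ≤ N) (hδ : ∀ t, 0 < δ t)
    (hQ₁ : RegularTransition fun _ : State D => Q₁) (hQ : ∀ i, RegularTransition (Q i))
    {f : (Fin (m + 1) → State D) → ℝ≥0∞} (hf : Measurable f) :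
    ∫⁻ x, ENNReal.ofReal (Q₁ (x 0)) *
        (pathWeight Q x * ∫⁻ y, f y ∂particleMALA N κ δ Q₁ Q x) =
      ∫⁻ x, ENNReal.ofReal (Q₁ (x 0)) * (pathWeight Q x * f x) := by
  have hq : Measurable Q₁ := hQ₁.measurable.of_uncurry_left (x := 0)
  have hd : Measurable (drift κ (δ 0) Q₁) :=
    measurable_drift_comp κ (δ 0) hQ₁ measurable_id measurable_id
  have hpw := measurable_pathWeight hQ
  let K : Fin (N + 1) → State D → Measure (Fin (N + 1) → State D) :=
    fun k x => propose κ (δ 0) Q₁ x k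
  have hK : ∀ k, Measurable (K k) := measurable_initial_propose hδ hQ₁
  have hKp : ∀ k x, IsProbabilityMeasure (K k x) := fun k x =>
    isProbabilityMeasure_propose κ (hδ 0) Q₁ x k
  let L : Fin (N + 1) → (Fin (m + 1) → State D) → (Fin (N + 1) → State D) → ℝ≥0∞ :=
    fun k x X => ∫⁻ y, f y ∂remainder κ m Q (fun i => δ i.succ) x 1 k X
        (normalise (weight κ (δ 0) (fun _ => Q₁) X))
  have hL : ∀ k, Measurable (Function.uncurry (L k)) := fun k =>
    (Measure.measurable_lintegral hf).comp (measurable_initial_remainder hN hδ hQ₁ hQ k)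
  have expand : ∀ x, ∫⁻ y, f y ∂particleMALA N κ δ Q₁ Q x =
      ∑ k, uniformIndex N {k} * ∫⁻ X, L k x X ∂K k (x 0) := by
    intro x
    rw [particleMALA_eq κ (hQ₁.pos 0) hQ, ← bind_of_finite, lintegral_bind_of_finite _ hf]
    refine Finset.sum_congr rfl fun k _ => ?_
    have hm : Measurable fun X => remainder κ m Q (fun i => δ i.succ) x 1 k X
        (normalise (weight κ (δ 0) (fun _ => Q₁) X)) := by
      have h := (measurable_initial_remainder (κ := κ) hN hδ hQ₁ hQ k).comp
        (measurable_prodMk_left (x := x))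
      exact h
    rw [Measure.lintegral_bind hm.aemeasurable hf.aemeasurable]
  -- the average over the reference position of the integral of a functional of the particles
  have average : ∀ M : Fin (N + 1) → (Fin (m + 1) → State D) → (Fin (N + 1) → State D) → ℝ≥0∞,
      (∀ k, Measurable (Function.uncurry (M k))) →
      ∫⁻ x, ENNReal.ofReal (Q₁ (x 0)) * (pathWeight Q x *
        ∑ k, uniformIndex N {k} * ∫⁻ X, M k x X ∂K k (x 0)) =
      ENNReal.ofReal (1 / ((N : ℝ) + 1)) * ∑ k, ∫⁻ x, ENNReal.ofReal (Q₁ x) *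
        ∫⁻ X, (∫⁻ z : Fin m → State D, pathWeight Q (Fin.cons x z) * M k (Fin.cons x z) X)
          ∂K k x := by
    intro M hM
    have hI : ∀ k, Measurable fun x : Fin (m + 1) → State D => ENNReal.ofReal (Q₁ (x 0)) *
        (pathWeight Q x * ∫⁻ X, M k x X ∂K k (x 0)) := fun k =>
      (hq.ennreal_ofReal.comp (measurable_pi_apply 0)).mul (hpw.mul
        (measurable_lintegral_of_isProbabilityMeasure ((hK k).comp (measurable_pi_apply 0))
          (fun x => hKp _ _) (hM k)))
    simp only [← lintegral_path_propose (hK _) (hKp _) hq.ennreal_ofReal hpw (hM _)]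
    rw [← lintegral_finsetSum _ fun k _ => hI k,
      ← lintegral_const_mul _ (Finset.measurable_sum _ fun k _ => hI k)]
    refine lintegral_congr fun x => ?_
    simp only [uniformIndex, categorical_singleton, Finset.mul_sum]
    refine Finset.sum_congr rfl fun k _ => ?_
    ring
  have hf2 : Measurable (Function.uncurry fun (x : Fin (m + 1) → State D)
      (_ : Fin (N + 1) → State D) => f x) := hf.comp measurable_fst
  -- Writing `f x` as an average over a proposal it does not depend on gives both sides the form to
  -- which the exchange principle applies.
  have hconst : ∀ x, f x = ∑ k, uniformIndex N {k} * ∫⁻ _X, f x ∂K k (x 0) := by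
    intro x
    simp only [lintegral_const, measure_univ, mul_one, ← Finset.sum_mul, sum_measure_singleton,
      one_mul]
  calc _ = ∫⁻ x, ENNReal.ofReal (Q₁ (x 0)) * (pathWeight Q x *
        ∑ k, uniformIndex N {k} * ∫⁻ X, L k x X ∂K k (x 0)) := by simp only [expand]
    _ = ∫⁻ x, ENNReal.ofReal (Q₁ (x 0)) * (pathWeight Q x *
        ∑ k, uniformIndex N {k} * ∫⁻ _X, f x ∂K k (x 0)) := by
      rw [average L hL, average (fun _ x _ => f x) fun _ => hf2]
      congr 1
      refine sum_lintegral_propose_congr (q := fun _ => Q₁) κ (hδ 0)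
        (fun _ => hQ₁.pos 0) (fun _ => hq) (fun _ => hd)
        (F := fun k x X =>
          ∫⁻ z : Fin m → State D, pathWeight Q (Fin.cons x z) * L k (Fin.cons x z) X)
        (G := fun _ x _ =>
          ∫⁻ z : Fin m → State D, pathWeight Q (Fin.cons x z) * f (Fin.cons x z)) ?_ ?_ ?_
      · intro k
        have h : Measurable fun r : (State D × (Fin (N + 1) → State D)) × (Fin m → State D) =>
            pathWeight Q (Fin.cons r.1.1 r.2) * L k (Fin.cons r.1.1 r.2) r.1.2 :=
          Measurable.mul (by fun_prop) (measurable_comp₂ (hL k) (by fun_prop) (by fun_prop))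
        exact h.lintegral_prod_right'
      · intro k
        have h : Measurable fun r : (State D × (Fin (N + 1) → State D)) × (Fin m → State D) =>
            pathWeight Q (Fin.cons r.1.1 r.2) * f (Fin.cons r.1.1 r.2) := by fun_prop
        exact h.lintegral_prod_right'
      · intro X
        have hw := weight_pos κ (δ 0) (fun _ => hQ₁.pos 0) X
        exact remainder_invariant hN κ hQ (fun i => hδ i.succ) X (normalise_pos hw)
          (sum_normalise hw) hf
    _ = _ := by simp only [← hconst]

lemma smoothing_bind_particleMALA (hN : 1 ≤ N) (hδ : ∀ t, 0 < δ t)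
    (hQ₁ : RegularTransition fun _ : State D => Q₁) (hQ : ∀ i, RegularTransition (Q i)) :
    (smoothing Q₁ Q).bind (particleMALA N κ δ Q₁ Q) = smoothing Q₁ Q := by
  have hP := measurable_particleMALA (κ := κ) hN hδ hQ₁ hQ
  have hq : Measurable Q₁ := hQ₁.measurable.of_uncurry_left (x := 0)
  have hpw := measurable_pathWeight hQ
  have hdens : Measurable fun x : Fin (m + 1) → State D =>
      ENNReal.ofReal (Q₁ (x 0)) * pathWeight Q x := by fun_prop
  -- The normalising constant passes through the kernel, so the unnormalised measure suffices.
  rw [smoothing, Measure.bind_smul]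
  congr 1
  simp only [ofReal_pathDensity (hQ₁.pos 0) hQ]
  refine Measure.ext_of_lintegral _ fun f hf => ?_
  have hPf : Measurable fun x => ∫⁻ y, f y ∂particleMALA N κ δ Q₁ Q x :=
    (Measure.measurable_lintegral hf).comp hP
  rw [Measure.lintegral_bind hP.aemeasurable hf.aemeasurable,
    lintegral_withDensity_eq_lintegral_mul _ hdens hPf,
    lintegral_withDensity_eq_lintegral_mul _ hdens hf]
  simp only [Pi.mul_apply, mul_assoc]
  exact lintegral_particleMALA hN hδ hQ₁ hQ hf

end Validity

end ParticleMALA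

theorem mainTheorem5 (D N m : ℕ) (hN : 1 ≤ N)
    (Q₁ : ParticleMALA.State D → ℝ)
    (Q : Fin m → ParticleMALA.State D → ParticleMALA.State D → ℝ)
    (hQ₁_pos : ∀ x, 0 < Q₁ x) (hQ_pos : ∀ i x y, 0 < Q i x y)
    (hQ₁_diff : Differentiable ℝ Q₁)
    (hQ_diff : ∀ i, Differentiable ℝ
      (fun p : ParticleMALA.State D × ParticleMALA.State D => Q i p.1 p.2))
    (hQ_int : Integrable (ParticleMALA.pathDensity Q₁ Q) volume)
    (κ : ℝ) (hκ : κ = 0 ∨ κ = 1)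
    (δ : Fin (m + 1) → ℝ) (hδ : ∀ t, 0 < δ t) :
    ∃ P : Kernel (Fin (m + 1) → ParticleMALA.State D) (Fin (m + 1) → ParticleMALA.State D),
      IsMarkovKernel P ∧
      (∀ x, P x = ParticleMALA.particleMALA N κ δ Q₁ Q x) ∧
      Kernel.Invariant P (ParticleMALA.smoothing Q₁ Q) := by
  have hQ₁ : ParticleMALA.RegularTransition fun _ : ParticleMALA.State D => Q₁ :=
    ParticleMALA.regularTransition_of_differentiable (fun _ => hQ₁_pos)
      (hQ₁_diff.comp differentiable_snd)
  have hQ : ∀ i, ParticleMALA.RegularTransition (Q i) := fun i =>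
    ParticleMALA.regularTransition_of_differentiable (hQ_pos i) (hQ_diff i)
  exact ⟨⟨ParticleMALA.particleMALA N κ δ Q₁ Q,
      ParticleMALA.measurable_particleMALA hN hδ hQ₁ hQ⟩,
    ⟨ParticleMALA.isProbabilityMeasure_particleMALA hN hδ hQ₁ hQ⟩, fun _ => rfl,
    ParticleMALA.smoothing_bind_particleMALA hN hδ hQ₁ hQ⟩
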